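/- \textbf{Conventions.} Complexes are finite abstract simplicial complexes with integer vertices; their generators are their maximal simplices. Stellar equivalence $\sim$ is generated by subdivisions $K=A\star \mathrm{lk}(A,K)+Q(A,K)\mapsto a\star\partial A\star \mathrm{lk}(A,K)+Q(A,K)$ (with $A$ a simplex of $K$, $a$ not a vertex of $K$, and $Q(A,K)$ the part of $K$ outside the star of $A$), their inverses (welds), and renumberings of vertices. A stellar $d$-ball is a complex stellar equivalent to the simplex $(1\,2\cdots d{+}1)$, and a stellar $d$-sphere is one stellar equivalent to $\partial(1\,2\cdots d{+}2)$. A stellar $n$-manifold is a complex in which every vertex link is a stellar $(n-1)$-ball or a stellar $(n-1)$-sphere. Topological properties of a complex are those of its geometric realization. A regular equivalence $\simeq$ on $S$ is a pair of equivalence relations, one on the vertices and one on the generators of $S$, such that (i) no generator has two different equivalent vertices; (ii) each generator is equivalent to at most one other generator, and every vertex of a generator $g$ is equal or equivalent to a vertex of any generator $p\simeq g$. The space $S/\simeq$ is the quotient of the realization $|S|$ obtained by identifying equivalent vertices, and identifying equivalent generators $g\simeq p$ by the affine map that takes each vertex of $g$ to the vertex of $p$ equivalent to it. For a vertex $a\notin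 S$, the cell complex $a\star(S/\simeq)$ is obtained from the cone $a\star S$ by the same identifications in $S$, while distinct simplices containing $a$ remain distinct. Its cells are embedded simplices, so starring all of its cells in the order of decreasing dimension yields a simplicial complex, its first derived subdivision; $M\sim a\star(S/\simeq)$ means that $M$ is stellar equivalent to this subdivision (with its vertices enumerated by integers). \textbf{Theorem.} Let $n>2$, let $S$ be a stellar $(n-1)$-sphere, let $\simeq$ be a regular equivalence on $S$, and let $a$ be a vertex not in $S$. If $M$ is a connected stellar $n$-manifold with $M\sim a\star(S/\simeq)$, then $$\pi_1(M,x)\cong\pi_1(S/\simeq,\,y)$$ for all base points $x\in |M|$ and $y\in S/\simeq$. -/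

import Mathlib

namespace Stellar

/-! ### Complexes and their elementary operations

A complex is a downward closed family of nonempty finite sets of vertices
(`PreAbstractSimplicialComplex`); the vertices of the complexes to which stellar moves are
applied are integers. -/

/-- The simplex with vertex set `A`: all nonempty subsets of `A`. -/
def simplex {ι : Type*} (A : Finset ι) : PreAbstractSimplicialComplex ι where
  faces := {F | F.Nonempty ∧ F ⊆ A}
  isRelLowerSet_faces := fun _ h => ⟨h.1, fun _ hG hne => ⟨hne, hG.trans h.2⟩⟩

/-- The boundary `∂A` of the simplex `A`: all nonempty proper subsets of `A`. -/
def simplexBoundary {ι : Type*} (A : Finset ι) : PreAbstractSimplicialComplex ι where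
  faces := {F | F.Nonempty ∧ F ⊂ A}
  isRelLowerSet_faces := fun _ h => ⟨h.1, fun _ hG hne => ⟨hne, lt_of_le_of_lt hG h.2⟩⟩

/-- The join `K ⋆ L` (used for complexes without common vertices): the simplices `P ∪ Q`, where
`P` is a simplex of `K` or empty, and `Q` is a simplex of `L` or empty. -/
def join {ι : Type*} [DecidableEq ι] (K L : PreAbstractSimplicialComplex ι) :
    PreAbstractSimplicialComplex ι where
  faces := {F | F.Nonempty ∧
    ∃ P Q : Finset ι, (P = ∅ ∨ P ∈ K.faces) ∧ (Q = ∅ ∨ Q ∈ L.faces) ∧ F = P ∪ Q}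
  isRelLowerSet_faces := by
    rintro F ⟨hF, P, Q, hP, hQ, rfl⟩
    refine ⟨hF, fun G hG hne => ⟨hne, P ∩ G, Q ∩ G, ?_, ?_, ?_⟩⟩
    · rcases hP with rfl | hP
      · simp
      · rcases (P ∩ G).eq_empty_or_nonempty with h | h
        · exact Or.inl h
        · exact Or.inr ((K.isRelLowerSet_faces hP).2 Finset.inter_subset_left h)
    · rcases hQ with rfl | hQ
      · simp
      · rcases (Q ∩ G).eq_empty_or_nonempty with h | h
        · exact Or.inl h
        · exact Or.inr ((L.isRelLowerSet_faces hQ).2 Finset.inter_subset_left h)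
    · rw [← Finset.union_inter_distrib_right]
      exact (Finset.inter_eq_right.mpr hG).symm

/-- The link `lk(A, K)`. -/
def link {ι : Type*} [DecidableEq ι] (A : Finset ι) (K : PreAbstractSimplicialComplex ι) :
    PreAbstractSimplicialComplex ι where
  faces := {B | B.Nonempty ∧ Disjoint A B ∧ A ∪ B ∈ K.faces}
  isRelLowerSet_faces := by
    rintro B ⟨hB, hd, hK⟩
    refine ⟨hB, fun C hC hne => ⟨hne, hd.mono_right hC, ?_⟩⟩
    exact (K.isRelLowerSet_faces hK).2 (Finset.union_subset_union_right hC)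
      (hne.mono Finset.subset_union_right)

/-- The subcomplex of the simplices of `K` that do not contain `A`. -/
def avoiding {ι : Type*} (A : Finset ι) (K : PreAbstractSimplicialComplex ι) :
    PreAbstractSimplicialComplex ι where
  faces := {F | F ∈ K.faces ∧ ¬ A ⊆ F}
  isRelLowerSet_faces := by
    rintro F ⟨hF, hA⟩
    exact ⟨(K.isRelLowerSet_faces hF).1, fun G hG hne =>
      ⟨(K.isRelLowerSet_faces hF).2 hG hne, fun h => hA (h.trans hG)⟩⟩

/-- The starring `(A a)K = a ⋆ ∂A ⋆ lk(A, K) + Q(A, K)` of `K` at its simplex `A`.  Here `Q(A, K)`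
is the part of `K` outside the star of `A`.  The simplices of the star that do not contain `A`
belong to `∂A ⋆ lk(A, K)` anyway, so `Q(A, K)` may be replaced by `avoiding A K`. -/
def starring {ι : Type*} [DecidableEq ι] (A : Finset ι) (a : ι)
    (K : PreAbstractSimplicialComplex ι) : PreAbstractSimplicialComplex ι :=
  join (simplex {a}) (join (simplexBoundary A) (link A K)) ⊔ avoiding A K

/-- The generators of a complex: its maximal simplices. -/
def IsGenerator {ι : Type*} (K : PreAbstractSimplicialComplex ι) (g : Finset ι) : Prop :=
  Maximal (fun F => F ∈ K.faces) g

/-! ### Stellar equivalence, stellar balls, spheres and manifolds -/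

/-- `L` is obtained from `K` by a subdivision, at some simplex of `K` and with a new vertex. -/
def IsSubdivision (K L : PreAbstractSimplicialComplex ℤ) : Prop :=
  ∃ A ∈ K.faces, ∃ a : ℤ, {a} ∉ K.faces ∧ L = starring A a K

/-- `L` is obtained from `K` by an (injective) renaming of the vertices. -/
def IsRenumbering {ι κ : Type*} [DecidableEq κ] (K : PreAbstractSimplicialComplex ι)
    (L : PreAbstractSimplicialComplex κ) : Prop :=
  ∃ f : ι → κ, Set.InjOn f {v | {v} ∈ K.faces} ∧ L = K.map f

/-- Stellar equivalence `K ∼ L`: the two complexes are connected by a finite sequence of stellar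
moves (subdivisions, their inverses, the welds, and renumberings of the vertices). -/
def StellarEquivalent : PreAbstractSimplicialComplex ℤ → PreAbstractSimplicialComplex ℤ → Prop :=
  Relation.EqvGen fun K L => IsSubdivision K L ∨ IsRenumbering K L

/-- A stellar `d`-ball: a complex stellar equivalent to the simplex `(1 2 … d+1)`. -/
def IsStellarBall (d : ℕ) (K : PreAbstractSimplicialComplex ℤ) : Prop :=
  StellarEquivalent K (simplex (Finset.Icc 1 ((d : ℤ) + 1)))

/-- A stellar `d`-sphere: a complex stellar equivalent to `∂(1 2 … d+2)`. -/
def IsStellarSphere (d : ℕ) (K : PreAbstractSimplicialComplex ℤ) : Prop :=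
  StellarEquivalent K (simplexBoundary (Finset.Icc 1 ((d : ℤ) + 2)))

/-- A stellar `n`-manifold: every vertex link is a stellar `(n-1)`-ball or a stellar
`(n-1)`-sphere.  (For `n = 0` the links are empty.) -/
def IsStellarManifold : ℕ → PreAbstractSimplicialComplex ℤ → Prop
  | 0, M => ∀ i : ℤ, {i} ∈ M.faces → link {i} M = ⊥
  | d + 1, M => ∀ i : ℤ, {i} ∈ M.faces →
      IsStellarBall d (link {i} M) ∨ IsStellarSphere d (link {i} M)

/-! ### Realization -/

/-- The standard geometric realization of a (finite) complex, in barycentric coordinates. -/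
def realization {ι : Type*} (K : PreAbstractSimplicialComplex ι) : Set (ι → ℝ) :=
  {x | (∀ v, 0 ≤ x v) ∧ ∃ F ∈ K.faces, (∀ v, v ∉ F → x v = 0) ∧ ∑ v ∈ F, x v = 1}

/-! ### Regular equivalences and the structure `a ⋆ (S/≃)` -/

/-- A regular equivalence on `S`: an equivalence relation on the vertices of `S` and one on the
generators of `S`, with the two regularity conditions.  (The relations are given on all integers
and on all finite sets of integers, but only their restrictions to the vertices and to the
generators of `S` are ever used.) -/
structure RegularEquivalence (S : PreAbstractSimplicialComplex ℤ) where
  vertexRel : Setoid ℤ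
  generatorRel : Setoid (Finset ℤ)
  /-- No generator has two different equivalent vertices. -/
  vertex_injective : ∀ g, IsGenerator S g → ∀ v ∈ g, ∀ w ∈ g, vertexRel v w → v = w
  /-- A generator is equivalent to at most one other generator. -/
  generator_pairs : ∀ g p q, IsGenerator S g → IsGenerator S p → IsGenerator S q →
    p ≠ g → q ≠ g → generatorRel g p → generatorRel g q → p = q
  /-- Every vertex of a generator is equal or equivalent to a vertex of any generator equivalent
  to it. -/
  vertex_matching : ∀ g p, IsGenerator S g → IsGenerator S p → generatorRel g p →
    ∀ v ∈ g, ∃ w ∈ p, vertexRel v w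

namespace RegularEquivalence

variable {S : PreAbstractSimplicialComplex ℤ}

/-- The elementary identifications of points of `|S|`.  Equivalent generators `g` and `p` are
identified by the affine map that sends every vertex of `g` to the vertex of `p` equivalent to it
(so identified points have equal barycentric coordinates at equivalent vertices), and equivalent
vertices are identified. -/
def PointGlue (E : RegularEquivalence S) (x y : realization S) : Prop :=
  (∃ g p, IsGenerator S g ∧ IsGenerator S p ∧ E.generatorRel g p ∧
    (∀ v, v ∉ g → x.1 v = 0) ∧ (∀ w, w ∉ p → y.1 w = 0) ∧
    ∀ v ∈ g, ∀ w ∈ p, E.vertexRel v w → x.1 v = y.1 w) ∨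
  (∃ v w, E.vertexRel v w ∧ x.1 = Pi.single v 1 ∧ y.1 = Pi.single w 1)

/-- The space `S/≃`: the quotient of `|S|` by the equivalence relation generated by
`PointGlue`, with the quotient topology. -/
abbrev QuotientSpace (E : RegularEquivalence S) : Type := Quot E.PointGlue

/-- The elementary identifications of simplices of `S`, induced in the same way: a face of a
generator `g` is identified with the corresponding face of an equivalent generator `p`, and
equivalent vertices are identified. -/
def FaceGlue (E : RegularEquivalence S) (α β : Finset ℤ) : Prop :=
  (∃ g p, IsGenerator S g ∧ IsGenerator S p ∧ E.generatorRel g p ∧ α ⊆ g ∧ β ⊆ p ∧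
    (∀ v ∈ α, ∃ w ∈ β, E.vertexRel v w) ∧ (∀ w ∈ β, ∃ v ∈ α, E.vertexRel v w)) ∨
  (∃ v w, {v} ∈ S.faces ∧ {w} ∈ S.faces ∧ E.vertexRel v w ∧ α = {v} ∧ β = {w})

/-- The cells of `a ⋆ (S/≃)` are the classes in this type of the simplices of `a ⋆ S`: simplices of
`S` are identified according to `FaceGlue`, while a simplex that contains `a` is only equivalent
to itself. -/
abbrev Cell (E : RegularEquivalence S) : Type := Quot E.FaceGlue

end RegularEquivalence

/-- The barycentric (first derived) subdivision: its vertices are the simplices of `K`, its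
simplices are the nonempty finite chains of simplices of `K`. -/
def barycentricSubdivision {ι : Type*} (K : PreAbstractSimplicialComplex ι) :
    PreAbstractSimplicialComplex (Finset ι) where
  faces := {C | C.Nonempty ∧ (∀ F ∈ C, F ∈ K.faces) ∧ IsChain (· ⊆ ·) (C : Set (Finset ι))}
  isRelLowerSet_faces := by
    rintro C ⟨hne, hK, hC⟩
    exact ⟨hne, fun D hD hne' => ⟨hne', fun F hF => hK F (hD hF),
      hC.mono (Finset.coe_subset.mpr hD)⟩⟩

open Classical in
/-- The first derived subdivision of `a ⋆ (S/≃)`: the barycentric subdivision of the cone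
`a ⋆ S` with the barycentres of identified simplices identified.  While `a ⋆ (S/≃)` need not be a
simplicial complex (different cells can have the same vertices), its cells are embedded simplices,
and starring all of them in the order of decreasing dimension produces this simplicial complex. -/
noncomputable def derivedStructure {S : PreAbstractSimplicialComplex ℤ} (a : ℤ)
    (E : RegularEquivalence S) : PreAbstractSimplicialComplex E.Cell :=
  (barycentricSubdivision (join (simplex {a}) S)).map (Quot.mk E.FaceGlue)

/-- `M ∼ a ⋆ (S/≃)`: the complex `M` is stellar equivalent to the first derived subdivision of
`a ⋆ (S/≃)`, with its vertices enumerated by integers. -/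
def HasStellarStructure (M : PreAbstractSimplicialComplex ℤ)
    {S : PreAbstractSimplicialComplex ℤ} (a : ℤ) (E : RegularEquivalence S) : Prop :=
  ∃ L : PreAbstractSimplicialComplex ℤ,
    IsRenumbering (derivedStructure a E) L ∧ StellarEquivalent M L

end Stellar

/-! Stellar moves preserve realizations, so `|M|` is homeomorphic to a space `Y` obtained from the
cone on a sphere of dimension `n - 1` by gluing its base to `X = S/≃`. Nothing off the base is
identified. Removing the apex leaves a space that deforms radially onto `X`. A neighbourhood of the
apex is an open `n`-ball with `n ≥ 3`, so paths and homotopies of paths can be pushed off the apex.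
Hence the inclusion of the punctured space into `Y` is an isomorphism on `π₁`, and `π₁(Y) ≅ π₁(X)`.

`ConeModel` isolates what this topological argument needs: a surjection from a cylinder that
collapses the bottom, is injective strictly between the ends, and glues the top exactly as `base`
does. General position is carried out in `ι → ℝ`, where `ι` has `n + 1` elements. Subtracting the
smallest coordinate gives polar coordinates on this space modulo constant vectors, and the apex
corresponds to the line of constants. A smooth map of the plane swept along that line has a
three-dimensional source, so it misses almost all of a space of dimension at least four
(`exists_approx_nonconstant`). The consequence is `exists_homotopy_avoiding_apex`, which gives
`bijective_map_inclusion`; the radial deformation is `baseHomotopyEquiv`.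

The combinatorial half produces such a model for the derived structure.
`StellarEquivalent.nonempty_homeomorph` handles the moves, and `barycentricHomeomorph` gives each
point of the cone its weights on a chain of simplices. Pushing these weights forward to cells is the
quotient map `coneMap`. Its fibres are controlled by regularity: comparable simplices are never
identified, and identified simplices have matching vertices. Thus two points have the same image
only if they are equal, or lie in the base and agree in `S/≃`. -/

namespace Stellar

open unitInterval Topology Set

/-! ### Spaces obtained from a cone on a sphere by gluing its base -/

/-- The boundary of the standard simplex with vertex set `ι`. -/
def simplexSphere (ι : Type*) [Fintype ι] : Set (ι → ℝ) :=
  {s | (∀ i, 0 ≤ s i) ∧ ∑ i, s i = 1 ∧ ∃ i, s i = 0}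

theorem isCompact_simplexSphere (ι : Type*) [Fintype ι] : IsCompact (simplexSphere ι) := by
  have h : simplexSphere ι = stdSimplex ℝ ι ∩ ⋃ i, {s | s i = 0} := by
    ext s
    simp [simplexSphere, stdSimplex, and_assoc]
  rw [h]
  refine (isCompact_stdSimplex ℝ ι).inter_right ?_
  exact isClosed_iUnion_of_finite fun i => isClosed_eq (continuous_apply i) continuous_const

instance (ι : Type*) [Fintype ι] : CompactSpace (simplexSphere ι) :=
  isCompact_iff_compactSpace.mp (isCompact_simplexSphere ι)

/-! ### Polar coordinates modulo constant vectors -/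

section Radial

variable {ι : Type*} [Fintype ι] [Nonempty ι]

/-- The smallest coordinate of a vector. -/
noncomputable def minCoord (v : ι → ℝ) : ℝ := Finset.univ.inf' Finset.univ_nonempty v

theorem minCoord_le (v : ι → ℝ) (i : ι) : minCoord v ≤ v i :=
  Finset.inf'_le _ (Finset.mem_univ i)

theorem exists_eq_minCoord (v : ι → ℝ) : ∃ i, v i = minCoord v := by
  obtain ⟨i, -, hi⟩ := Finset.exists_mem_eq_inf' (Finset.univ_nonempty (α := ι)) v
  exact ⟨i, hi.symm⟩

theorem continuous_minCoord : Continuous (minCoord (ι := ι)) :=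
  Continuous.finset_inf'_apply _ fun i _ => continuous_apply i

/-- The sum of the coordinates of a vector after subtracting the smallest one. -/
noncomputable def spread (v : ι → ℝ) : ℝ := ∑ i, (v i - minCoord v)

theorem spread_nonneg (v : ι → ℝ) : 0 ≤ spread v :=
  Finset.sum_nonneg fun i _ => sub_nonneg.mpr (minCoord_le v i)

theorem continuous_spread : Continuous (spread (ι := ι)) :=
  continuous_finsetSum _ fun i _ => (continuous_apply i).sub continuous_minCoord

theorem eq_minCoord_of_spread_eq_zero {v : ι → ℝ} (h : spread v = 0) (i : ι) :
    v i = minCoord v := by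
  have := (Finset.sum_eq_zero_iff_of_nonneg
    (fun i _ => sub_nonneg.mpr (minCoord_le v i))).mp h i (Finset.mem_univ i)
  linarith

theorem minCoord_eq_zero {v : ι → ℝ} (h : ∀ i, 0 ≤ v i) (h0 : ∃ i, v i = 0) :
    minCoord v = 0 := by
  obtain ⟨i, hi⟩ := h0
  obtain ⟨j, hj⟩ := exists_eq_minCoord v
  exact le_antisymm (hi ▸ minCoord_le v i) (hj ▸ h j)

/-- The direction of a non-constant vector in the quotient by the constant vectors, as a point of
the boundary of the simplex; a constant vector is sent to the given point. -/
noncomputable def direction (s₀ : simplexSphere ι) (v : ι → ℝ) : simplexSphere ι :=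
  if h : spread v = 0 then s₀ else
    ⟨fun i => (v i - minCoord v) / spread v,
      fun i => div_nonneg (sub_nonneg.mpr (minCoord_le v i)) (spread_nonneg v), by
        rw [← Finset.sum_div]; exact div_self h, by
        obtain ⟨i, hi⟩ := exists_eq_minCoord v
        exact ⟨i, by simp [hi]⟩⟩

theorem continuousAt_direction (s₀ : simplexSphere ι) {v : ι → ℝ} (h : spread v ≠ 0) :
    ContinuousAt (direction s₀) v := by
  rw [Topology.IsInducing.subtypeVal.continuousAt_iff]
  have h1 : ContinuousAt (fun v : ι → ℝ => fun i => (v i - minCoord v) / spread v) v :=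
    continuousAt_pi.mpr fun i => ((continuous_apply i).sub continuous_minCoord).continuousAt.div
      continuous_spread.continuousAt h
  refine h1.congr ?_
  filter_upwards [continuous_spread.continuousAt.eventually_ne h] with w hw
  simp [direction, hw]

/-- Some coordinate of `s` vanishes, so the smallest coordinate of `t * s` is zero and nothing is
subtracted. Together with `direction_smul` this says that `spread` and `direction` recover the polar
coordinates `t` and `s`. -/
theorem spread_smul (s : simplexSphere ι) {t : ℝ} (ht : 0 ≤ t) :
    spread (fun i => t * s.1 i) = t := by
  have : minCoord (fun i => t * s.1 i) = 0 := by
    obtain ⟨i, hi⟩ := s.2.2.2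
    exact minCoord_eq_zero (fun i => mul_nonneg ht (s.2.1 i)) ⟨i, by simp [hi]⟩
  simp [spread, this, ← Finset.mul_sum, s.2.2.1]

theorem direction_smul (s₀ s : simplexSphere ι) {t : ℝ} (ht : 0 < t) :
    direction s₀ (fun i => t * s.1 i) = s := by
  have : minCoord (fun i => t * s.1 i) = 0 := by
    obtain ⟨i, hi⟩ := s.2.2.2
    exact minCoord_eq_zero (fun i => mul_nonneg ht.le (s.2.1 i)) ⟨i, by simp [hi]⟩
  ext i
  simp [direction, spread_smul s ht.le, this, ht.ne']

end Radial

/-- A map onto `Y` from the cylinder on the boundary of a simplex which exhibits `Y` as the cone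
with its base glued according to a quotient map `base` onto `X`. -/
structure ConeModel (ι X Y : Type*) [Fintype ι] [TopologicalSpace X] [TopologicalSpace Y] where
  base : simplexSphere ι → X
  isQuotientMap_base : IsQuotientMap base
  cyl : simplexSphere ι × I → Y
  continuous_cyl : Continuous cyl
  surjective_cyl : Function.Surjective cyl
  apex_eq : ∀ s s', cyl (s, 0) = cyl (s', 0)
  height_eq : ∀ {s s' t t'}, cyl (s, t) = cyl (s', t') → t = t'
  base_eq : ∀ {s s' t t'}, cyl (s, t) = cyl (s', t') → 0 < t → base s = base s'
  inner_eq : ∀ {s s' t t'}, cyl (s, t) = cyl (s', t') → 0 < t → t < 1 → s = s'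
  glue : ∀ {s s'}, base s = base s' → cyl (s, 1) = cyl (s', 1)

namespace ConeModel

variable {ι X Y : Type*} [Fintype ι] [TopologicalSpace X] [TopologicalSpace Y]
  (C : ConeModel ι X Y)

/-- The cylinder is compact and `Y` is Hausdorff, so `cyl` is closed. Continuity on `Y` can
therefore be checked on the cylinder; no separation property of `X` is needed. -/
theorem isQuotientMap_cyl [T2Space Y] : IsQuotientMap C.cyl :=
  C.continuous_cyl.isClosedMap.isQuotientMap C.continuous_cyl C.surjective_cyl

/-- The height of a point above the apex. -/
noncomputable def height (y : Y) : I := (Function.surjInv C.surjective_cyl y).2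

@[simp] theorem height_cyl (s : simplexSphere ι) (t : I) : C.height (C.cyl (s, t)) = t :=
  C.height_eq (Function.surjInv_eq C.surjective_cyl (C.cyl (s, t)))

theorem exists_cyl (y : Y) : ∃ s, y = C.cyl (s, C.height y) := by
  obtain ⟨⟨s, t⟩, rfl⟩ := C.surjective_cyl y
  exact ⟨s, by simp⟩

theorem continuous_height [T2Space Y] : Continuous C.height :=
  C.isQuotientMap_cyl.continuous_iff.mpr (by
    have : C.height ∘ C.cyl = Prod.snd := by ext ⟨s, t⟩; simp
    rw [this]; exact continuous_snd)

/-- Coordinates near the apex, extended by zero to the base. -/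
noncomputable def chart (y : Y) : ι → ℝ := fun i =>
  min (C.height y : ℝ) (1 - C.height y) * (Function.surjInv C.surjective_cyl y).1.1 i

/-- The point `s` is determined by the image only for `0 < t < 1`. The factor `min t (1 - t)`
vanishes at both ends, so the arbitrary choice made there has no effect. -/
theorem chart_cyl (s : simplexSphere ι) (t : I) :
    C.chart (C.cyl (s, t)) = fun i => min (t : ℝ) (1 - t) * s.1 i := by
  ext i
  simp only [chart, height_cyl]
  have h := Function.surjInv_eq C.surjective_cyl (C.cyl (s, t))
  generalize Function.surjInv C.surjective_cyl (C.cyl (s, t)) = p at h ⊢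
  obtain ⟨s', t'⟩ := p
  obtain rfl : t' = t := C.height_eq h
  rcases eq_or_lt_of_le t'.2.1 with h0 | h0
  · simp [← h0]
  rcases eq_or_lt_of_le t'.2.2 with h1 | h1
  · simp [h1]
  obtain rfl : s' = s := C.inner_eq h h0 h1
  rfl

theorem continuous_chart [T2Space Y] : Continuous C.chart :=
  C.isQuotientMap_cyl.continuous_iff.mpr (by
    have : C.chart ∘ C.cyl = fun p => fun i => min (p.2 : ℝ) (1 - p.2) * p.1.1 i := by
      ext ⟨s, t⟩ i
      simp [chart_cyl]
    rw [this]
    have hp : Continuous fun p : simplexSphere ι × I => (p.2 : ℝ) :=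
      continuous_subtype_val.comp continuous_snd
    exact continuous_pi fun i => (hp.min (continuous_const.sub hp)).mul
      ((continuous_apply i).comp (continuous_subtype_val.comp continuous_fst)))

section Ball

variable [Nonempty ι]

/-- The inverse of the chart, extended to all vectors. -/
noncomputable def ball (s₀ : simplexSphere ι) (v : ι → ℝ) : Y :=
  C.cyl (direction s₀ v, projIcc 0 1 zero_le_one (spread v))

/-- Only vectors of spread zero are delicate, since `direction` need not be continuous there. As
`cyl` collapses the whole sphere at height zero, compactness of the sphere gives one height below
which the entire cylinder maps into a prescribed neighbourhood of the apex. -/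
theorem continuous_ball (s₀ : simplexSphere ι) : Continuous (C.ball s₀) := by
  have hp : Continuous fun v : ι → ℝ => projIcc (0 : ℝ) 1 zero_le_one (spread v) :=
    continuous_projIcc.comp continuous_spread
  refine continuous_iff_continuousAt.mpr fun v => ?_
  by_cases h : spread v = 0
  · intro O hO
    have hv : C.ball s₀ v = C.cyl (s₀, 0) := by
      rw [ball, h]
      simpa using C.apex_eq _ _
    rw [hv] at hO
    have h1 : ∀ᶠ t : I in 𝓝 0, ∀ s ∈ (univ : Set (simplexSphere ι)), C.cyl (s, t) ∈ O := by
      refine isCompact_univ.eventually_forall_of_forall_eventually fun s _ => ?_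
      have : C.cyl ⁻¹' O ∈ 𝓝 ((s, 0) : simplexSphere ι × I) :=
        C.continuous_cyl.continuousAt (by rwa [C.apex_eq s s₀])
      have h2 : Filter.Tendsto (Prod.swap : I × simplexSphere ι → _) (𝓝 (0, s)) (𝓝 (s, 0)) :=
        continuous_swap.continuousAt
      exact h2 this
    have h3 : Filter.Tendsto (fun v : ι → ℝ => projIcc (0 : ℝ) 1 zero_le_one (spread v)) (𝓝 v)
        (𝓝 0) := by
      have := hp.continuousAt (x := v)
      rw [ContinuousAt, h] at this
      simpa using this
    refine Filter.mem_map.mpr ?_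
    filter_upwards [h3.eventually h1] with w hw
    exact hw _ (mem_univ _)
  · exact C.continuous_cyl.continuousAt.comp
      ((continuousAt_direction s₀ h).prodMk hp.continuousAt)

theorem spread_eq_zero_of_ball_eq {s₀ : simplexSphere ι} {v : ι → ℝ}
    (h : C.height (C.ball s₀ v) = 0) : spread v = 0 := by
  rw [ball, height_cyl] at h
  by_contra h0
  have := (lt_of_le_of_ne (spread_nonneg v) (Ne.symm h0))
  have h2 : spread v ≤ 0 := (projIcc_eq_left zero_lt_one).mp h
  linarith

/-- Up to height `1 / 2` the factor in the chart is the height itself, so the chart is exactly the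
polar vector. -/
theorem ball_chart (s₀ : simplexSphere ι) {y : Y} (hy : (C.height y : ℝ) ≤ 1 / 2) :
    C.ball s₀ (C.chart y) = y := by
  obtain ⟨s, hs⟩ := C.exists_cyl y
  set t := C.height y
  rw [hs, chart_cyl, min_eq_left (by linarith), ball, spread_smul s t.2.1]
  simp only [projIcc_val]
  rcases eq_or_lt_of_le t.2.1 with h0 | h0
  · have : t = 0 := Subtype.ext h0.symm
    rw [this]
    exact C.apex_eq _ _
  · rw [direction_smul s₀ s h0]

end Ball

end ConeModel

end Stellar

/-! ### General position: pushing maps of the square off the apex -/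

namespace Stellar

open unitInterval Topology Set

/-- Every continuous map from the plane into a real coordinate space of dimension at least four can
be approximated by a continuous map none of whose values is a constant vector. -/
theorem exists_approx_nonconstant {ι : Type*} [Fintype ι] (hι : 4 ≤ Fintype.card ι)
    {g : ℝ × ℝ → ι → ℝ} (hg : Continuous g) {ε : ℝ} (hε : 0 < ε) :
    ∃ P : ℝ × ℝ → ι → ℝ, Continuous P ∧ (∀ z, dist (P z) (g z) < ε) ∧
      ∀ z (c : ℝ), ∃ i, P z i ≠ c := by
  obtain ⟨P, hP, hPg, -⟩ := hg.exists_contDiff_approx (ε := fun _ => ε / 2) 1 continuous_const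
    fun _ => half_pos hε
  -- The line of constants adds one dimension to the plane, and `3 < 4`, so the swept image has
  -- dense complement. Translating `P` by a small missed vector `v` makes every value nonconstant:
  -- `P z - v = c • 1` would put `v` in the image.
  have hd : Dense (range fun z : (ℝ × ℝ) × ℝ => P z.1 + z.2 • (1 : ι → ℝ))ᶜ := by
    refine ContDiff.dense_compl_range_of_finrank_lt_finrank ?_ ?_
    · exact ((hP.comp contDiff_fst).add (contDiff_snd.smul contDiff_const))
    · simp
      omega
  obtain ⟨v, hv, hvε⟩ := hd.exists_dist_lt 0 (half_pos hε)
  refine ⟨fun z => P z - v, hP.continuous.sub continuous_const, fun z => ?_, fun z c => ?_⟩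
  · calc dist (P z - v) (g z) ≤ dist (P z - v) (P z) + dist (P z) (g z) := dist_triangle _ _ _
      _ < ε / 2 + ε / 2 := by
        refine add_lt_add ?_ (hPg z)
        simpa [dist_eq_norm] using hvε
      _ = ε := by ring
  · by_contra! h
    refine hv ⟨(z, -c), ?_⟩
    ext i
    have := h i
    simp only [Pi.sub_apply] at this
    simp only [Pi.add_apply, Pi.smul_apply, Pi.one_apply, smul_eq_mul]
    linarith

namespace ConeModel

variable {ι X Y : Type*} [Fintype ι] [TopologicalSpace X] [TopologicalSpace Y] [T2Space Y]
  (C : ConeModel ι X Y)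

/-- General position: a map of the square can be pushed off the apex by a homotopy that moves only
points close to the apex. -/
theorem exists_homotopy_avoiding_apex (hι : 4 ≤ Fintype.card ι) (f : C(I × I, Y)) {δ : ℝ}
    (hδ : 0 < δ) (hδ' : δ ≤ 1 / 2) :
    ∃ F : C(I × (I × I), Y), (∀ z, F (0, z) = f z) ∧ (∀ z, C.height (F (1, z)) ≠ 0) ∧
      ∀ u z, δ ≤ C.height (f z) → F (u, z) = f z := by
  classical
  have hcard : (0 : ℝ) < Fintype.card ι := by
    have : 0 < Fintype.card ι := by omega
    exact_mod_cast this
  have : Nonempty ι := Fintype.card_pos_iff.mp (by omega)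
  obtain ⟨⟨s₀, -⟩, -⟩ := C.surjective_cyl (f (0, 0))
  -- Chosen so that `card ι * (2 * ε) = δ / 8` is below `δ / 2`: in the zone where the cutoff is
  -- partial, a vector within `ε` of the chart cannot be constant.
  set ε : ℝ := δ / (16 * Fintype.card ι) with hε
  have hεpos : 0 < ε := by positivity
  -- Clamping extends the map of the square to the plane, where smooth approximation is available.
  let pr : ℝ × ℝ → I × I := fun z => (projIcc 0 1 zero_le_one z.1, projIcc 0 1 zero_le_one z.2)
  have hpr : Continuous pr := by
    exact (continuous_projIcc.comp continuous_fst).prodMk (continuous_projIcc.comp continuous_snd)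
  have hprz : ∀ z : I × I, pr (z.1, z.2) = z := fun z => by simp [pr]
  obtain ⟨P, hP, hPg, hPc⟩ := exists_approx_nonconstant hι
    (g := fun z => C.chart (f (pr z))) (C.continuous_chart.comp (f.continuous.comp hpr)) hεpos
  let Q : I × I → ι → ℝ := fun z => P (z.1, z.2)
  have hQ : Continuous Q := hP.comp
    ((continuous_subtype_val.comp continuous_fst).prodMk
      (continuous_subtype_val.comp continuous_snd))
  have hQg : ∀ z, dist (Q z) (C.chart (f z)) < ε := fun z => by
    have := hPg (z.1, z.2)
    rwa [hprz] at this
  let τ : I × I → ℝ := fun z => C.height (f z)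
  have hτ : Continuous τ := continuous_subtype_val.comp (C.continuous_height.comp f.continuous)
  -- A cutoff equal to `1` up to height `δ / 2` and to `0` from height `δ` on.
  let φ : I × I → ℝ := fun z => min 1 (max 0 (2 - 2 * τ z / δ))
  have hφ : Continuous φ := by
    exact continuous_const.min (continuous_const.max
      (continuous_const.sub ((continuous_const.mul hτ).div_const _)))
  have hφ0 : ∀ z, δ ≤ τ z → φ z = 0 := fun z hz => by
    have : 2 - 2 * τ z / δ ≤ 0 := by
      rw [sub_nonpos, le_div_iff₀ hδ]; linarith
    simp [φ, max_eq_left this]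
  have hφ1 : ∀ z, τ z ≤ δ / 2 → φ z = 1 := fun z hz => by
    have : 1 ≤ 2 - 2 * τ z / δ := by
      have : 2 * τ z / δ ≤ 1 := by rw [div_le_one hδ]; linarith
      linarith
    exact min_eq_left (this.trans (le_max_right _ _))
  have hφI : ∀ z, 0 ≤ φ z ∧ φ z ≤ 1 := fun z =>
    ⟨le_min zero_le_one (le_max_left _ _), min_le_left _ _⟩
  let w : I × (I × I) → ι → ℝ := fun p =>
    C.chart (f p.2) + ((p.1 : ℝ) * φ p.2) • (Q p.2 - C.chart (f p.2))
  have hcf : Continuous fun p : I × (I × I) => C.chart (f p.2) :=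
    C.continuous_chart.comp (f.continuous.comp continuous_snd)
  have hw : Continuous w := hcf.add
    (((continuous_subtype_val.comp continuous_fst).mul (hφ.comp continuous_snd)).smul
      ((hQ.comp continuous_snd).sub hcf))
  -- The two formulas agree at height `δ`: the cutoff vanishes there, and `ball` inverts the chart
  -- because `δ ≤ 1 / 2`.
  let F : I × (I × I) → Y := fun p => if δ ≤ τ p.2 then f p.2 else C.ball s₀ (w p)
  have hF : Continuous F := by
    refine Continuous.if_le (f.continuous.comp continuous_snd) ((C.continuous_ball s₀).comp hw)
      continuous_const (hτ.comp continuous_snd) fun p hp => ?_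
    have : w p = C.chart (f p.2) := by simp [w, hφ0 p.2 hp.le]
    rw [this]
    exact (C.ball_chart s₀ (by change τ p.2 ≤ _; rw [← show δ = τ p.2 from hp]; exact hδ')).symm
  refine ⟨⟨F, hF⟩, fun z => ?_, fun z => ?_, fun u z h => if_pos h⟩
  · by_cases hz : δ ≤ τ z
    · exact if_pos hz
    · have : w (0, z) = C.chart (f z) := by simp [w]
      change (if δ ≤ τ z then f z else C.ball s₀ (w (0, z))) = f z
      rw [if_neg hz, this]
      exact C.ball_chart s₀ ((not_le.mp hz).le.trans hδ')
  · by_cases hz : δ ≤ τ z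
    · change C.height (if δ ≤ τ z then f z else C.ball s₀ (w (1, z))) ≠ 0
      rw [if_pos hz]
      intro h0
      have : τ z = 0 := by simp [τ, h0]
      linarith
    · change C.height (if δ ≤ τ z then f z else C.ball s₀ (w (1, z))) ≠ 0
      rw [if_neg hz]
      intro h0
      have hconst := eq_minCoord_of_spread_eq_zero (C.spread_eq_zero_of_ball_eq h0)
      -- Reaching the apex means that `w (1, z)` is constant. At low height it equals `Q z`, which
      -- is never constant. Higher up it stays within `ε` of `τ z * s`; a vanishing coordinate of
      -- `s` bounds the constant by `ε`, so each `τ z * s i` is at most `2 * ε`, and summing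
      -- contradicts `τ z > δ / 2`.
      rcases le_or_gt (τ z) (δ / 2) with hz2 | hz2
      · have : w (1, z) = Q z := by simp [w, hφ1 z hz2]
        rw [this] at hconst
        obtain ⟨i, hi⟩ := hPc (z.1, z.2) (minCoord (Q z))
        exact hi (hconst i)
      · set c := minCoord (w (1, z))
        obtain ⟨s, hs⟩ := C.exists_cyl (f z)
        have hch : C.chart (f z) = fun i => τ z * s.1 i := by
          rw [hs, chart_cyl, min_eq_left]
          change τ z ≤ 1 - τ z
          linarith [not_le.mp hz]
        have hclose : ∀ i, |c - τ z * s.1 i| ≤ ε := fun i => by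
          have h1 : c = τ z * s.1 i + φ z * (Q z i - τ z * s.1 i) := by
            rw [← hconst i]
            simp [w, hch]
          have h2 : |Q z i - τ z * s.1 i| ≤ ε := by
            have := (dist_le_pi_dist (Q z) (C.chart (f z)) i).trans (hQg z).le
            rwa [Real.dist_eq, hch] at this
          rw [h1, add_sub_cancel_left, abs_mul, abs_of_nonneg (hφI z).1]
          calc φ z * |Q z i - τ z * s.1 i| ≤ 1 * ε :=
                mul_le_mul (hφI z).2 h2 (abs_nonneg _) zero_le_one
            _ = ε := one_mul _
        obtain ⟨i₀, hi₀⟩ := s.2.2.2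
        have hc : c ≤ ε := by
          have := hclose i₀
          rw [hi₀, mul_zero, sub_zero] at this
          exact (le_abs_self _).trans this
        have hsum : τ z ≤ Fintype.card ι * (2 * ε) := by
          calc τ z = ∑ i, τ z * s.1 i := by rw [← Finset.mul_sum, s.2.2.1, mul_one]
            _ ≤ ∑ _i : ι, 2 * ε := Finset.sum_le_sum fun i _ => by
                have := (abs_le.mp (hclose i)).1
                linarith
            _ = Fintype.card ι * (2 * ε) := by simp
        have : (Fintype.card ι : ℝ) * (2 * ε) = δ / 8 := by
          rw [hε]; field_simp; norm_num
        linarith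

end ConeModel

end Stellar

/-! ### Fundamental groups of the punctured and the full cone space -/

namespace Stellar

open unitInterval Topology Set

/-- Homotopy equivalent spaces have isomorphic fundamental groups. -/
noncomputable def fundamentalGroupMulEquivOfHomotopyEquiv {X Y : Type*} [TopologicalSpace X]
    [TopologicalSpace Y] (e : ContinuousMap.HomotopyEquiv X Y) (x : X) :
    FundamentalGroup X x ≃* FundamentalGroup Y (e x) :=
  ((FundamentalGroupoidFunctor.equivOfHomotopyEquiv e).fullyFaithfulFunctor).mulEquivEnd
    (FundamentalGroupoid.mk x)

theorem nonempty_fundamentalGroup_mulEquiv_of_homeomorph {X Y : Type*} [TopologicalSpace X]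
    [TopologicalSpace Y] (e : X ≃ₜ Y) (x : X) :
    Nonempty (FundamentalGroup X x ≃* FundamentalGroup Y (e x)) :=
  ⟨fundamentalGroupMulEquivOfHomotopyEquiv e.toHomotopyEquiv x⟩

namespace ConeModel

variable {ι X Y : Type*} [Fintype ι] [TopologicalSpace X] [TopologicalSpace Y]
  (C : ConeModel ι X Y)

/-- The complement of the apex. -/
def punctured : Set Y := {y | C.height y ≠ 0}

theorem mem_punctured_cyl {s : simplexSphere ι} {t : I} : C.cyl (s, t) ∈ C.punctured ↔ t ≠ 0 := by
  simp [punctured]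

/-- The radial projection of the complement of the apex to the glued base. -/
noncomputable def toBase (y : C.punctured) : X :=
  C.base (Function.surjInv C.surjective_cyl y.1).1

theorem toBase_cyl {s : simplexSphere ι} {t : I} (h : C.cyl (s, t) ∈ C.punctured) :
    C.toBase ⟨C.cyl (s, t), h⟩ = C.base s := by
  have h1 := Function.surjInv_eq C.surjective_cyl (C.cyl (s, t))
  rw [toBase]
  generalize Function.surjInv C.surjective_cyl (C.cyl (s, t)) = p at h1 ⊢
  obtain ⟨s', t'⟩ := p
  obtain rfl : t' = t := C.height_eq h1
  exact C.base_eq h1 (unitInterval.pos_iff_ne_zero.mpr (C.mem_punctured_cyl.mp h))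

/-- The inclusion of the glued base. -/
noncomputable def ofBase (x : X) : C.punctured :=
  ⟨C.cyl (Function.surjInv C.isQuotientMap_base.surjective x, 1), C.mem_punctured_cyl.mpr one_ne_zero⟩

theorem ofBase_base (s : simplexSphere ι) :
    C.ofBase (C.base s) = ⟨C.cyl (s, 1), C.mem_punctured_cyl.mpr one_ne_zero⟩ :=
  Subtype.ext (C.glue (Function.surjInv_eq C.isQuotientMap_base.surjective _))

theorem continuous_ofBase : Continuous C.ofBase := by
  refine C.isQuotientMap_base.continuous_iff.mpr ?_
  have : C.ofBase ∘ C.base = fun s => ⟨C.cyl (s, 1), C.mem_punctured_cyl.mpr one_ne_zero⟩ :=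
    funext C.ofBase_base
  rw [this]
  exact Continuous.subtype_mk (C.continuous_cyl.comp (Continuous.prodMk continuous_id
    continuous_const)) _

theorem toBase_ofBase (x : X) : C.toBase (C.ofBase x) = x := by
  obtain ⟨s, rfl⟩ := C.isQuotientMap_base.surjective x
  rw [ofBase_base, toBase_cyl]

/-- The radial deformation of the complement of the apex to the glued base. -/
noncomputable def push (p : I × C.punctured) : C.punctured :=
  ⟨C.cyl ((Function.surjInv C.surjective_cyl p.2.1).1, σ (σ p.1 * σ (C.height p.2.1))), by
    rw [mem_punctured_cyl]
    have := unitInterval.pos_iff_ne_zero.mpr p.2.2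
    intro h
    have h1 : (σ p.1 : ℝ) * (1 - C.height p.2.1) = 1 := by
      have := congrArg (Subtype.val ∘ σ) h
      simpa using this
    have h2 : (0 : ℝ) < C.height p.2.1 := this
    have h3 := (σ p.1).2.2
    have h4 := (C.height p.2.1).2.2
    nlinarith [mul_nonneg (sub_nonneg.mpr h3) (sub_nonneg.mpr h4)]⟩

/-- The height `1 - (1 - u) * (1 - t)` runs from `t` to `1`. Below the top, `s` is determined by the
point; at the top the height stays `1`, so any chosen representative gives back the same point. -/
theorem push_cyl (u : I) {s : simplexSphere ι} {t : I} (h : C.cyl (s, t) ∈ C.punctured) :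
    (C.push (u, ⟨C.cyl (s, t), h⟩)).1 = C.cyl (s, σ (σ u * σ t)) := by
  have h1 := Function.surjInv_eq C.surjective_cyl (C.cyl (s, t))
  simp only [push, height_cyl]
  generalize Function.surjInv C.surjective_cyl (C.cyl (s, t)) = p at h1 ⊢
  obtain ⟨s', t'⟩ := p
  obtain rfl : t' = t := C.height_eq h1
  have ht : 0 < t' := unitInterval.pos_iff_ne_zero.mpr (C.mem_punctured_cyl.mp h)
  rcases eq_or_ne t' 1 with rfl | h2
  · simpa using h1
  · obtain rfl : s' = s := C.inner_eq h1 ht (unitInterval.lt_one_iff_ne_one.mpr h2)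
    rfl

theorem isOpen_punctured [T2Space Y] : IsOpen C.punctured :=
  isOpen_ne.preimage C.continuous_height

theorem continuous_toBase [T2Space Y] : Continuous C.toBase := by
  refine (C.isQuotientMap_cyl.restrictPreimage_isOpen C.isOpen_punctured).continuous_iff.mpr ?_
  have : C.toBase ∘ C.punctured.restrictPreimage C.cyl = fun p => C.base p.1.1 :=
    funext fun p => C.toBase_cyl p.2
  rw [this]
  exact C.isQuotientMap_base.continuous.comp (continuous_fst.comp continuous_subtype_val)

/-- A product of a quotient map with an identity need not be a quotient map in general; here `id ×
cyl` is one, again as a surjection from a compact space to a Hausdorff space, and it restricts to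
one over the open punctured part. -/
theorem continuous_push [T2Space Y] : Continuous C.push := by
  have hq : IsQuotientMap (Prod.map (id : I → I) C.cyl) := by
    have hc : Continuous (Prod.map (id : I → I) C.cyl) := continuous_id.prodMap C.continuous_cyl
    have : CompactSpace Y := C.surjective_cyl.compactSpace C.continuous_cyl
    exact hc.isClosedMap.isQuotientMap hc (Function.surjective_id.prodMap C.surjective_cyl)
  have hV : IsOpen ((Prod.snd : I × Y → Y) ⁻¹' C.punctured) :=
    C.isOpen_punctured.preimage continuous_snd
  have h1 : Continuous fun p : (Prod.snd : I × Y → Y) ⁻¹' C.punctured =>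
      C.push (p.1.1, ⟨p.1.2, p.2⟩) := by
    refine (hq.restrictPreimage_isOpen hV).continuous_iff.mpr ?_
    rw [Topology.IsInducing.subtypeVal.continuous_iff]
    have : (Subtype.val ∘ (fun p : (Prod.snd : I × Y → Y) ⁻¹' C.punctured =>
        C.push (p.1.1, ⟨p.1.2, p.2⟩)) ∘ (Prod.snd ⁻¹' C.punctured).restrictPreimage
          (Prod.map (id : I → I) C.cyl)) =
        fun p => C.cyl (p.1.2.1, σ (σ p.1.1 * σ p.1.2.2)) :=
      funext fun p => C.push_cyl p.1.1 p.2
    rw [this]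
    refine C.continuous_cyl.comp ?_
    fun_prop
  have h2 : Continuous fun p : I × C.punctured =>
      (⟨(p.1, p.2.1), p.2.2⟩ : (Prod.snd : I × Y → Y) ⁻¹' C.punctured) := by fun_prop
  exact h1.comp h2

/-- The glued base is homotopy equivalent to the complement of the apex. -/
noncomputable def baseHomotopyEquiv [T2Space Y] : ContinuousMap.HomotopyEquiv X C.punctured where
  toFun := ⟨C.ofBase, C.continuous_ofBase⟩
  invFun := ⟨C.toBase, C.continuous_toBase⟩
  left_inv := by
    have : (ContinuousMap.comp ⟨C.toBase, C.continuous_toBase⟩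
        ⟨C.ofBase, C.continuous_ofBase⟩) = ContinuousMap.id X :=
      ContinuousMap.ext C.toBase_ofBase
    rw [this]
  right_inv := by
    refine ContinuousMap.Homotopic.symm ⟨⟨⟨C.push, C.continuous_push⟩, fun y => ?_, fun y => ?_⟩⟩
    · obtain ⟨y, hy⟩ := y
      obtain ⟨⟨s, t⟩, rfl⟩ := C.surjective_cyl y
      exact Subtype.ext ((C.push_cyl 0 hy).trans (by simp))
    · obtain ⟨y, hy⟩ := y
      obtain ⟨⟨s, t⟩, rfl⟩ := C.surjective_cyl y
      refine Subtype.ext ((C.push_cyl 1 hy).trans ?_)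
      simp [toBase_cyl, ofBase_base]

/-- The inclusion of the complement of the apex. -/
def inclusion : C(C.punctured, Y) := ⟨Subtype.val, continuous_subtype_val⟩

theorem height_pos_of_mem (y : C.punctured) : (0 : ℝ) < C.height y.1 :=
  unitInterval.pos_iff_ne_zero.mpr y.2

theorem exists_path_homotopic [T2Space Y] (hι : 4 ≤ Fintype.card ι) (u₀ u₁ : C.punctured)
    (p : Path (C.inclusion u₀) (C.inclusion u₁)) :
    ∃ p' : Path u₀ u₁, p.Homotopic (p'.map C.inclusion.continuous) := by
  -- With `δ` at most the height of both endpoints, the pushing homotopy leaves them fixed. The path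
  -- is viewed as a map of the square independent of the second coordinate.
  set δ : ℝ := min (1 / 2) (min (C.height u₀.1 : ℝ) (C.height u₁.1)) with hδ
  have hδ0 : 0 < δ := lt_min (by norm_num) (lt_min (C.height_pos_of_mem _) (C.height_pos_of_mem _))
  obtain ⟨F, hF0, hF1, hFrel⟩ := C.exists_homotopy_avoiding_apex hι
    (p.toContinuousMap.comp ⟨Prod.fst, continuous_fst⟩) hδ0 (min_le_left _ _)
  have e0 : ∀ u, F (u, (0, 0)) = u₀.1 := fun u => by
    have h : (p.toContinuousMap.comp ⟨Prod.fst, continuous_fst⟩) ((0, 0) : I × I) = u₀.1 := p.source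
    rw [hFrel u (0, 0), h]
    rw [h]
    exact (min_le_right _ _).trans (min_le_left _ _)
  have e1 : ∀ u, F (u, (1, 0)) = u₁.1 := fun u => by
    have h : (p.toContinuousMap.comp ⟨Prod.fst, continuous_fst⟩) ((1, 0) : I × I) = u₁.1 := p.target
    rw [hFrel u (1, 0), h]
    rw [h]
    exact (min_le_right _ _).trans (min_le_right _ _)
  refine ⟨⟨⟨fun t => ⟨F (1, (t, 0)), hF1 _⟩, by fun_prop⟩, Subtype.ext (e0 1), Subtype.ext (e1 1)⟩,
    ⟨⟨⟨⟨fun z => F (z.1, (z.2, 0)), by fun_prop⟩, fun t => hF0 _, fun t => rfl⟩, ?_⟩⟩⟩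
  rintro u t (rfl | ht)
  · exact (e0 u).trans p.source.symm
  · obtain rfl : t = 1 := ht
    exact (e1 u).trans p.target.symm

theorem homotopic_of_map_homotopic [T2Space Y] (hι : 4 ≤ Fintype.card ι) {u₀ u₁ : C.punctured}
    (p p' : Path u₀ u₁) (h : (p.map C.inclusion.continuous).Homotopic
      (p'.map C.inclusion.continuous)) : p.Homotopic p' := by
  obtain ⟨H⟩ := h
  have hcont : Continuous fun t : I => min (min (C.height (p t).1 : ℝ) (C.height (p' t).1))
      (min (C.height u₀.1 : ℝ) (C.height u₁.1)) := by
    have hh := C.continuous_height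
    fun_prop
  -- By compactness the boundary of the square stays at positive height, at least `m`. Pushing with
  -- `δ ≤ m` then leaves both paths and both endpoints untouched.
  obtain ⟨t₀, ht₀⟩ := hcont.exists_forall_le' 0 (by simp)
  set m := min (min (C.height (p t₀).1 : ℝ) (C.height (p' t₀).1))
      (min (C.height u₀.1 : ℝ) (C.height u₁.1)) with hm
  have hm0 : 0 < m := lt_min (lt_min (C.height_pos_of_mem _) (C.height_pos_of_mem _))
    (lt_min (C.height_pos_of_mem _) (C.height_pos_of_mem _))
  obtain ⟨F, hF0, hF1, hFrel⟩ := C.exists_homotopy_avoiding_apex hι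
    H.toContinuousMap (δ := min (1 / 2) m) (lt_min (by norm_num) hm0) (min_le_left _ _)
  have key : ∀ z : I × I, ∀ y : C.punctured, H z = y.1 → m ≤ C.height y.1 → F (1, z) = y.1 :=
    fun z y hz hy => by
      have hz' : H.toContinuousMap z = y.1 := hz
      rw [hFrel 1 z (by rw [hz']; exact (min_le_right _ _).trans hy), hz']
  refine ⟨⟨⟨⟨fun z => ⟨F (1, z), hF1 _⟩, by fun_prop⟩, fun t => ?_, fun t => ?_⟩, ?_⟩⟩
  · exact Subtype.ext (key _ (p t) (H.map_zero_left t)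
      ((ht₀ t).trans ((min_le_left _ _).trans (min_le_left _ _))))
  · exact Subtype.ext (key _ (p' t) (H.map_one_left t)
      ((ht₀ t).trans ((min_le_left _ _).trans (min_le_right _ _))))
  · rintro u t (rfl | ht)
    · refine Subtype.ext ((key _ u₀ (H.source u) ?_).trans
        (congrArg Subtype.val p.source.symm))
      exact (min_le_right _ _).trans (min_le_left _ _)
    · obtain rfl : t = 1 := ht
      refine Subtype.ext ((key _ u₁ (H.target u) ?_).trans
        (congrArg Subtype.val p.target.symm))
      exact (min_le_right _ _).trans (min_le_right _ _)

theorem bijective_map_inclusion [T2Space Y] (hι : 4 ≤ Fintype.card ι) (u : C.punctured) :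
    Function.Bijective (FundamentalGroup.map C.inclusion u) := by
  constructor
  · intro a b hab
    obtain ⟨p, rfl⟩ := Path.Homotopic.Quotient.mk_surjective a
    obtain ⟨p', rfl⟩ := Path.Homotopic.Quotient.mk_surjective b
    refine Path.Homotopic.Quotient.eq.mpr (C.homotopic_of_map_homotopic hι p p' ?_)
    exact Path.Homotopic.Quotient.exact hab
  · intro b
    obtain ⟨p, rfl⟩ := Path.Homotopic.Quotient.mk_surjective b
    obtain ⟨p', hp'⟩ := C.exists_path_homotopic hι u u p
    exact ⟨Path.Homotopic.Quotient.mk p', (Path.Homotopic.Quotient.eq.mpr hp').symm⟩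

/-- Each point is joined to the apex by a radial segment. This is what allows an arbitrary base
point in `Y`. -/
theorem pathConnectedSpace (C : ConeModel ι X Y) [Nonempty Y] : PathConnectedSpace Y := by
  obtain ⟨⟨s₀, -⟩, -⟩ := C.surjective_cyl (Classical.arbitrary Y)
  have h : ∀ y, Joined (C.cyl (s₀, 0)) y := fun y => by
    obtain ⟨⟨s, t⟩, rfl⟩ := C.surjective_cyl y
    refine ⟨⟨⟨fun r => C.cyl (s, r * t), C.continuous_cyl.comp (by fun_prop)⟩, ?_, ?_⟩⟩
    · simpa using C.apex_eq _ _
    · simp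
  exact ⟨inferInstance, fun y z => (h y).symm.trans (h z)⟩

/-- Attaching a cone on a sphere of dimension at least two does not change the fundamental
group. -/
theorem nonempty_fundamentalGroup_mulEquiv (C : ConeModel ι X Y) [T2Space Y]
    (hι : 4 ≤ Fintype.card ι) (y : Y) (x : X) :
    Nonempty (FundamentalGroup Y y ≃* FundamentalGroup X x) := by
  have : Nonempty Y := ⟨y⟩
  have := C.pathConnectedSpace
  have e1 := fundamentalGroupMulEquivOfHomotopyEquiv C.baseHomotopyEquiv x
  have e2 := MulEquiv.ofBijective _ (C.bijective_map_inclusion hι (C.baseHomotopyEquiv x))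
  have e3 := FundamentalGroup.fundamentalGroupMulEquivOfPathConnected
    (C.inclusion (C.baseHomotopyEquiv x)) y
  exact ⟨((e1.trans e2).trans e3).symm⟩

end ConeModel

end Stellar

namespace Stellar

open Set

/-! ### Homeomorphic realizations -/

section Realization

variable {ι κ : Type*}

theorem mem_faces_of_subset {K : PreAbstractSimplicialComplex ι} {F G : Finset ι}
    (hF : F ∈ K.faces) (hG : G ⊆ F) (hne : G.Nonempty) : G ∈ K.faces :=
  (K.isRelLowerSet_faces hF).2 hG hne

theorem nonempty_of_mem_faces {K : PreAbstractSimplicialComplex ι} {F : Finset ι}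
    (hF : F ∈ K.faces) : F.Nonempty :=
  (K.isRelLowerSet_faces hF).1

theorem singleton_mem_faces {K : PreAbstractSimplicialComplex ι} {F : Finset ι}
    (hF : F ∈ K.faces) {v : ι} (hv : v ∈ F) : {v} ∈ K.faces :=
  mem_faces_of_subset hF (Finset.singleton_subset_iff.mpr hv) (Finset.singleton_nonempty v)

/-- A point of the realization lies in the relative interior of a face. -/
theorem exists_support_face {K : PreAbstractSimplicialComplex ι} {x : ι → ℝ}
    (hx : x ∈ realization K) :
    ∃ F ∈ K.faces, (∀ v, v ∈ F ↔ 0 < x v) ∧ ∑ v ∈ F, x v = 1 := by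
  classical
  obtain ⟨h0, F, hF, hFx, hsum⟩ := hx
  have hs : ∑ v ∈ F with 0 < x v, x v = 1 := by
    rw [← hsum]
    refine Finset.sum_filter_of_ne fun v _ hv => lt_of_le_of_ne (h0 v) hv.symm
  have hne : (F.filter fun v => 0 < x v).Nonempty := by
    by_contra h
    rw [Finset.not_nonempty_iff_eq_empty] at h
    simp [h] at hs
  refine ⟨F.filter fun v => 0 < x v, mem_faces_of_subset hF (Finset.filter_subset _ _) hne,
    fun v => ?_, hs⟩
  simp only [Finset.mem_filter, and_iff_right_iff_imp]
  intro hv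
  by_contra h
  exact hv.ne' (hFx v h)

theorem mem_realization_of_support {K : PreAbstractSimplicialComplex ι} {x : ι → ℝ}
    {F : Finset ι} (h0 : ∀ v, 0 ≤ x v) (hF : ∀ v, x v ≠ 0 → v ∈ F) (hsum : ∑ v ∈ F, x v = 1)
    (hK : F.filter (fun v => 0 < x v) ∈ K.faces) : x ∈ realization K := by
  refine ⟨h0, _, hK, fun v hv => ?_, ?_⟩
  · by_contra h
    exact hv (Finset.mem_filter.mpr ⟨hF v h, lt_of_le_of_ne (h0 v) (Ne.symm h)⟩)
  · rw [← hsum]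
    exact Finset.sum_filter_of_ne fun v _ hv => lt_of_le_of_ne (h0 v) hv.symm

/-- Renaming the vertices does not change the realization. -/
theorem nonempty_homeomorph_of_isRenumbering [DecidableEq κ] {K : PreAbstractSimplicialComplex ι}
    {L : PreAbstractSimplicialComplex κ} (h : IsRenumbering K L) :
    Nonempty (realization K ≃ₜ realization L) := by
  classical
  obtain ⟨f, hf, rfl⟩ := h
  rcases isEmpty_or_nonempty ι with hι | hι
  · have h1 : IsEmpty (realization K) := ⟨fun x => by
      obtain ⟨F, hF, -⟩ := exists_support_face x.2
      exact (nonempty_of_mem_faces hF).elim fun v _ => hι.elim v⟩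
    have h2 : IsEmpty (realization (K.map f)) := ⟨fun x => by
      obtain ⟨F, ⟨G, hG, rfl⟩, -⟩ := exists_support_face x.2
      exact (nonempty_of_mem_faces hG).elim fun v _ => hι.elim v⟩
    exact ⟨Homeomorph.empty⟩
  set V : Set ι := {v | {v} ∈ K.faces} with hV
  let g : κ → ι := Function.invFunOn f V
  have hgf : ∀ v ∈ V, g (f v) = v := fun v hv => hf.leftInvOn_invFunOn hv
  have hFV : ∀ F ∈ K.faces, ∀ v ∈ F, v ∈ V := fun F hF v hv => singleton_mem_faces hF hv
  have hinj : ∀ F ∈ K.faces, Set.InjOn f F := fun F hF => hf.mono fun v hv => hFV F hF v hv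
  let φ : (ι → ℝ) → κ → ℝ := fun x w => if w ∈ f '' V then x (g w) else 0
  let ψ : (κ → ℝ) → ι → ℝ := fun y v => if v ∈ V then y (f v) else 0
  have hφc : Continuous φ := continuous_pi fun w => by
    by_cases hw : w ∈ f '' V
    · simpa only [φ, hw, if_true] using continuous_apply (g w)
    · simpa only [φ, hw, if_false] using continuous_const
  have hψc : Continuous ψ := continuous_pi fun v => by
    by_cases hv : v ∈ V
    · simpa only [ψ, hv, if_true] using continuous_apply (f v)
    · simpa only [ψ, hv, if_false] using continuous_const
  have hφf : ∀ x, ∀ v ∈ V, φ x (f v) = x v := fun x v hv => by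
    simp only [φ, Set.mem_image_of_mem f hv, if_true, hgf v hv]
  have hφm : ∀ x ∈ realization K, φ x ∈ realization (K.map f) := by
    rintro x ⟨h0, F, hF, hFx, hsum⟩
    refine ⟨fun w => ?_, F.image f, ⟨F, hF, rfl⟩, fun w hw => ?_, ?_⟩
    · by_cases hw : w ∈ f '' V
      · simpa only [φ, hw, if_true] using h0 _
      · simp only [φ, hw, if_false, le_refl]
    · by_cases hw' : w ∈ f '' V
      · obtain ⟨v, hv, rfl⟩ := hw'
        rw [hφf x v hv]
        exact hFx v fun hv => hw (Finset.mem_image_of_mem f hv)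
      · simp only [φ, hw', if_false]
    · rw [Finset.sum_image (hinj F hF), ← hsum]
      exact Finset.sum_congr rfl fun v hv => hφf x v (hFV F hF v hv)
  have hψm : ∀ y ∈ realization (K.map f), ψ y ∈ realization K := by
    rintro y ⟨h0, _, ⟨F, hF, rfl⟩, hFy, hsum⟩
    refine ⟨fun v => ?_, F, hF, fun v hv => ?_, ?_⟩
    · by_cases hv : v ∈ V
      · simpa only [ψ, hv, if_true] using h0 _
      · simp only [ψ, hv, if_false, le_refl]
    · by_cases hv' : v ∈ V
      · simp only [ψ, hv', if_true]
        refine hFy _ fun h => ?_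
        obtain ⟨u, hu, huv⟩ := Finset.mem_image.mp h
        exact hv (hf (hFV F hF u hu) hv' huv ▸ hu)
      · simp only [ψ, hv', if_false]
    · rw [← hsum, Finset.sum_image (hinj F hF)]
      exact Finset.sum_congr rfl fun v hv => by simp only [ψ, hFV F hF v hv, if_true]
  refine ⟨⟨⟨fun x => ⟨φ x.1, hφm _ x.2⟩, fun y => ⟨ψ y.1, hψm _ y.2⟩, fun x => ?_, fun y => ?_⟩,
    ?_, ?_⟩⟩
  · ext v
    by_cases hv : v ∈ V
    · simp only [ψ, hv, if_true]
      exact hφf _ v hv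
    · simp only [ψ, hv, if_false]
      obtain ⟨-, F, hF, hFx, -⟩ := x.2
      exact (hFx v fun h => hv (hFV F hF v h)).symm
  · ext w
    by_cases hw : w ∈ f '' V
    · obtain ⟨v, hv, rfl⟩ := hw
      simp only [hφf _ v hv]
      simp only [ψ, hv, if_true]
    · simp only [φ, hw, if_false]
      obtain ⟨-, _, ⟨F, hF, rfl⟩, hFy, -⟩ := y.2
      refine (hFy w fun h => hw ?_).symm
      obtain ⟨v, hv, rfl⟩ := Finset.mem_image.mp h
      exact Set.mem_image_of_mem f (hFV F hF v hv)
  · exact (hφc.comp continuous_subtype_val).subtype_mk _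
  · exact (hψc.comp continuous_subtype_val).subtype_mk _

end Realization

/-! ### Starring and the realization -/

section Starring

variable {ι : Type*} [DecidableEq ι] {K : PreAbstractSimplicialComplex ι} {A : Finset ι} {a : ι}

/-- The iterated join is replaced by a direct criterion: any `B` with `A ∪ B` in `K` and `A ⊄ B`
splits uniquely as `B ∩ A`, in `∂A` or empty, and `B \ A`, in the link or empty. -/
theorem mem_faces_starring_iff (hA : A ∈ K.faces) (ha : {a} ∉ K.faces) {F : Finset ι} :
    F ∈ (starring A a K).faces ↔ (a ∉ F ∧ F ∈ K.faces ∧ ¬ A ⊆ F) ∨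
      (a ∈ F ∧ A ∪ F.erase a ∈ K.faces ∧ ¬ A ⊆ F.erase a) := by
  have hAne := nonempty_of_mem_faces hA
  have hav : ∀ G ∈ K.faces, a ∉ G := fun G hG h => ha (singleton_mem_faces hG h)
  constructor
  · rintro (⟨hne, P, Q, hP, hQ, rfl⟩ | ⟨hF, hAF⟩)
    · have hQ' : A ∪ Q ∈ K.faces ∧ ¬ A ⊆ Q := by
        rcases hQ with rfl | ⟨-, P', Q', hP', hQ', rfl⟩
        · simpa [hA] using hAne.ne_empty
        · have h1 : A ∪ (P' ∪ Q') = A ∪ Q' := by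
            have : P' ⊆ A := by
              rcases hP' with rfl | h
              · simp
              · exact h.2.1
            rw [← Finset.union_assoc, Finset.union_eq_left.mpr this]
          rw [h1]
          have h2 : Disjoint A Q' := by
            rcases hQ' with rfl | h
            · simp
            · exact h.2.1
          constructor
          · rcases hQ' with rfl | h
            · simpa using hA
            · exact h.2.2
          · intro h
            have h3 : A ⊆ P' := fun v hv =>
              (Finset.mem_union.mp (h hv)).resolve_right (Finset.disjoint_left.mp h2 hv)
            rcases hP' with rfl | hP'
            · exact hAne.ne_empty (Finset.subset_empty.mp h3)
            · exact hP'.2.2 h3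
      have haQ : a ∉ Q := fun h => hav _ hQ'.1 (Finset.mem_union_right _ h)
      have hP : P = ∅ ∨ P = {a} := by
        rcases hP with h | h
        · exact Or.inl h
        · exact Finset.subset_singleton_iff.mp h.2
      rcases hP with rfl | rfl
      · left
        rw [Finset.empty_union] at hne ⊢
        exact ⟨haQ, mem_faces_of_subset hQ'.1 Finset.subset_union_right hne, hQ'.2⟩
      · right
        have : ({a} ∪ Q).erase a = Q := Finset.erase_insert haQ
        rw [this]
        exact ⟨Finset.mem_union_left _ (Finset.mem_singleton_self a), hQ'⟩
    · exact Or.inl ⟨hav F hF, hF, hAF⟩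
  · rintro (h | ⟨haF, hK, hAF⟩)
    · exact Or.inr h.2
    · set B := F.erase a with hB
      have hFB : F = {a} ∪ B := (Finset.insert_erase haF).symm
      refine Or.inl ⟨⟨a, haF⟩, {a}, B, Or.inr ⟨by simp, by simp⟩, ?_, hFB⟩
      rcases B.eq_empty_or_nonempty with h | h
      · exact Or.inl h
      refine Or.inr ⟨h, B ∩ A, B \ A, ?_, ?_, ?_⟩
      · rcases (B ∩ A).eq_empty_or_nonempty with h | h
        · exact Or.inl h
        · exact Or.inr ⟨h, Finset.inter_subset_right, fun hle =>
            hAF (hle.trans Finset.inter_subset_left)⟩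
      · rcases (B \ A).eq_empty_or_nonempty with h | h
        · exact Or.inl h
        · refine Or.inr ⟨h, Finset.disjoint_sdiff, ?_⟩
          rwa [Finset.union_sdiff_self_eq_union]
      · ext v
        simp only [Finset.mem_union, Finset.mem_inter, Finset.mem_sdiff]
        tauto

/-- A starring does not change the realization. -/
theorem nonempty_homeomorph_starring (hA : A ∈ K.faces) (ha : {a} ∉ K.faces) :
    Nonempty (realization (starring A a K) ≃ₜ realization K) := by
  have hAne := nonempty_of_mem_faces hA
  have hav : ∀ G ∈ K.faces, a ∉ G := fun G hG h => ha (singleton_mem_faces hG h)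
  have haA : a ∉ A := hav A hA
  have hcard : (0 : ℝ) < A.card := by exact_mod_cast hAne.card_pos
  -- The new vertex is placed at the barycentre of `A`. Thus `φ` distributes the weight of `a`
  -- evenly over `A`, and `ψ` takes out of `A` the largest multiple of its barycentre, whose size is
  -- governed by the minimum `m` over `A`.
  let m : (ι → ℝ) → ℝ := fun y => A.inf' hAne y
  have hm : Continuous m := Continuous.finset_inf'_apply hAne fun i _ => continuous_apply i
  let φ : (ι → ℝ) → ι → ℝ := fun x v => if v = a then 0 else
    if v ∈ A then x v + x a / A.card else x v
  let ψ : (ι → ℝ) → ι → ℝ := fun y v => if v = a then A.card * m y else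
    if v ∈ A then y v - m y else y v
  have hφc : Continuous φ := continuous_pi fun v => by
    simp only [φ]
    split_ifs <;> fun_prop
  have hψc : Continuous ψ := continuous_pi fun v => by
    simp only [ψ]
    split_ifs <;> fun_prop
  have hφa : ∀ x, φ x a = 0 := fun x => by simp [φ]
  have hφA : ∀ x, ∀ v ∈ A, φ x v = x v + x a / A.card := fun x v hv => by
    have : v ≠ a := fun h => haA (h ▸ hv)
    simp [φ, hv, this]
  have hφo : ∀ x, ∀ v ∉ A, v ≠ a → φ x v = x v := fun x v hv hva => by simp [φ, hv, hva]
  have hψa : ∀ y, ψ y a = A.card * m y := fun x => by simp [ψ]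
  have hψA : ∀ y, ∀ v ∈ A, ψ y v = y v - m y := fun x v hv => by
    have : v ≠ a := fun h => haA (h ▸ hv)
    simp [ψ, hv, this]
  have hψo : ∀ y, ∀ v ∉ A, v ≠ a → ψ y v = y v := fun x v hv hva => by simp [ψ, hv, hva]
  have hmle : ∀ y, ∀ v ∈ A, m y ≤ y v := fun y v hv => Finset.inf'_le y hv
  have hmex : ∀ y, ∃ v ∈ A, m y = y v := fun y => Finset.exists_mem_eq_inf' hAne y
  have hφ0 : ∀ x, x a = 0 → φ x = x := fun x hx => by
    ext v
    by_cases hva : v = a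
    · rw [hva, hφa, hx]
    by_cases hv : v ∈ A
    · rw [hφA x v hv, hx, zero_div, add_zero]
    · exact hφo x v hv hva
  have hψ0 : ∀ y, y a = 0 → m y = 0 → ψ y = y := fun y hy hy' => by
    ext v
    by_cases hva : v = a
    · rw [hva, hψa, hy, hy', mul_zero]
    by_cases hv : v ∈ A
    · rw [hψA y v hv, hy', sub_zero]
    · exact hψo y v hv hva
  have hKa : ∀ y ∈ realization K, y a = 0 := by
    rintro y ⟨-, F, hF, hFy, -⟩
    exact hFy a (hav F hF)
  have hφm : ∀ x ∈ realization (starring A a K), φ x ∈ realization K := by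
    rintro x ⟨h0, F, hF, hFx, hsum⟩
    rcases (mem_faces_starring_iff hA ha).mp hF with ⟨haF, hFK, -⟩ | ⟨haF, hFK, -⟩
    · rw [hφ0 x (hFx a haF)]
      exact ⟨h0, F, hFK, hFx, hsum⟩
    · refine ⟨fun v => ?_, _, hFK, fun v hv => ?_, ?_⟩
      · simp only [φ]
        split_ifs
        · exact le_rfl
        · exact add_nonneg (h0 v) (div_nonneg (h0 a) hcard.le)
        · exact h0 v
      · by_cases hva : v = a
        · rw [hva, hφa]
        · have hvA : v ∉ A := fun h => hv (Finset.mem_union_left _ h)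
          rw [hφo x v hvA hva]
          exact hFx v fun h => hv (Finset.mem_union_right _ (Finset.mem_erase.mpr ⟨hva, h⟩))
      · have h1 : ∀ v ∈ A ∪ F.erase a, φ x v = x v + if v ∈ A then x a / A.card else 0 :=
          fun v hv => by
            by_cases hvA : v ∈ A
            · rw [hφA x v hvA, if_pos hvA]
            · rw [hφo x v hvA fun h => hav _ hFK (h ▸ hv), if_neg hvA, add_zero]
        rw [Finset.sum_congr rfl h1, Finset.sum_add_distrib, Finset.sum_ite_mem,
          Finset.union_inter_cancel_left, Finset.sum_const, nsmul_eq_mul,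
          mul_div_cancel₀ _ hcard.ne', ← hsum, ← Finset.sum_erase_add _ _ haF]
        congr 1
        refine (Finset.sum_subset Finset.subset_union_right fun v hv hvF => hFx v fun h => ?_).symm
        exact hvF (Finset.mem_erase.mpr ⟨fun h => hav _ hFK (h ▸ hv), h⟩)
  have hψm : ∀ y ∈ realization K, ψ y ∈ realization (starring A a K) := by
    intro y hy
    have hya := hKa y hy
    obtain ⟨F, hF, hFy, hsum⟩ := exists_support_face hy
    have h0 := hy.1
    obtain ⟨v₀, hv₀, hmv₀⟩ := hmex y
    have hm0 : 0 ≤ m y := hmv₀ ▸ h0 v₀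
    rcases eq_or_lt_of_le hm0 with hm0 | hm0
    · rw [hψ0 y hya hm0.symm]
      refine ⟨h0, F, (mem_faces_starring_iff hA ha).mpr (Or.inl ⟨hav F hF, hF, fun h => ?_⟩),
        fun v hv => ?_, hsum⟩
      · have := (hFy v₀).mp (h hv₀)
        rw [← hmv₀, ← hm0] at this
        exact lt_irrefl _ this
      · exact le_antisymm (not_lt.mp fun h => hv ((hFy v).mpr h)) (h0 v)
    · have hAF : A ⊆ F := fun v hv => (hFy v).mpr (hm0.trans_le (hmle y v hv))
      refine mem_realization_of_support (F := insert a F) (fun v => ?_) (fun v hv => ?_) ?_ ?_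
      · by_cases hva : v = a
        · rw [hva, hψa]; positivity
        by_cases hv : v ∈ A
        · rw [hψA y v hv]; exact sub_nonneg.mpr (hmle y v hv)
        · rw [hψo y v hv hva]; exact h0 v
      · by_contra h
        rw [Finset.mem_insert, not_or] at h
        refine hv ?_
        rw [hψo y v (fun hvA => h.2 (hAF hvA)) h.1]
        exact le_antisymm (not_lt.mp fun h' => h.2 ((hFy v).mpr h')) (h0 v)
      · rw [Finset.sum_insert (hav F hF), hψa]
        have h1 : ∀ v ∈ F, ψ y v = y v - if v ∈ A then m y else 0 := fun v hv => by
          by_cases hvA : v ∈ A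
          · rw [hψA y v hvA, if_pos hvA]
          · rw [hψo y v hvA fun h => hav _ hF (h ▸ hv), if_neg hvA, sub_zero]
        rw [Finset.sum_congr rfl h1, Finset.sum_sub_distrib, Finset.sum_ite_mem,
          Finset.inter_eq_right.mpr hAF, Finset.sum_const, nsmul_eq_mul, hsum]
        ring
      · have hpa : 0 < ψ y a := by rw [hψa]; positivity
        rw [Finset.filter_insert, if_pos hpa]
        have haB : a ∉ F.filter fun v => 0 < ψ y v := fun h =>
          hav F hF (Finset.mem_filter.mp h).1
        refine (mem_faces_starring_iff hA ha).mpr (Or.inr ⟨Finset.mem_insert_self _ _, ?_, ?_⟩)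
        · rw [Finset.erase_insert haB]
          exact mem_faces_of_subset hF (Finset.union_subset hAF (Finset.filter_subset _ _))
            (hAne.mono Finset.subset_union_left)
        · rw [Finset.erase_insert haB]
          intro h
          have := (Finset.mem_filter.mp (h hv₀)).2
          rw [hψA y v₀ hv₀, hmv₀, sub_self] at this
          exact lt_irrefl _ this
  -- No simplex of the starring contains all of `A`, so some coordinate in `A` vanishes before the
  -- weight of `a` is distributed, and the minimum afterwards is exactly the share of `a`.
  have hmφ : ∀ x ∈ realization (starring A a K), m (φ x) = x a / A.card := by
    rintro x ⟨h0, F, hF, hFx, -⟩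
    have hAF : ¬ A ⊆ F := by
      rcases (mem_faces_starring_iff hA ha).mp hF with ⟨-, -, h⟩ | ⟨-, -, h⟩
      · exact h
      · exact fun hAF => h fun v hv => Finset.mem_erase.mpr ⟨fun e => haA (e ▸ hv), hAF hv⟩
    obtain ⟨v, hvA, hvF⟩ := Finset.not_subset.mp hAF
    refine le_antisymm ?_ ?_
    · refine (hmle _ v hvA).trans ?_
      rw [hφA x v hvA, hFx v hvF, zero_add]
    · obtain ⟨w, hw, hmw⟩ := hmex (φ x)
      rw [hmw, hφA x w hw]
      exact le_add_of_nonneg_left (h0 w)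
  refine ⟨⟨⟨fun x => ⟨φ x.1, hφm _ x.2⟩, fun y => ⟨ψ y.1, hψm _ y.2⟩, fun x => ?_, fun y => ?_⟩,
    (hφc.comp continuous_subtype_val).subtype_mk _, (hψc.comp continuous_subtype_val).subtype_mk _⟩⟩
  · ext v
    change ψ (φ x.1) v = x.1 v
    by_cases hva : v = a
    · rw [hva, hψa, hmφ _ x.2, mul_div_cancel₀ _ hcard.ne']
    by_cases hv : v ∈ A
    · rw [hψA _ v hv, hφA _ v hv, hmφ _ x.2, add_sub_cancel_right]
    · rw [hψo _ v hv hva, hφo _ v hv hva]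
  · ext v
    change φ (ψ y.1) v = y.1 v
    by_cases hva : v = a
    · rw [hva, hφa, hKa _ y.2]
    by_cases hv : v ∈ A
    · rw [hφA _ v hv, hψA _ v hv, hψa, mul_div_cancel_left₀ _ hcard.ne', sub_add_cancel]
    · rw [hφo _ v hv hva, hψo _ v hv hva]

end Starring

/-- Stellar equivalent complexes have homeomorphic realizations. -/
theorem StellarEquivalent.nonempty_homeomorph {K L : PreAbstractSimplicialComplex ℤ}
    (h : StellarEquivalent K L) : Nonempty (realization K ≃ₜ realization L) := by
  induction h with
  | rel K L h =>
    rcases h with ⟨A, hA, a, ha, rfl⟩ | h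
    · exact (nonempty_homeomorph_starring hA ha).map Homeomorph.symm
    · exact nonempty_homeomorph_of_isRenumbering h
  | refl K => exact ⟨Homeomorph.refl _⟩
  | symm K L _ ih => exact ih.map Homeomorph.symm
  | trans K L N _ _ ih₁ ih₂ => exact ih₁.elim fun e₁ => ih₂.map e₁.trans

/-- Stellar moves preserve finiteness. -/
theorem StellarEquivalent.finite_vertices_iff {K L : PreAbstractSimplicialComplex ℤ}
    (h : StellarEquivalent K L) :
    {v | {v} ∈ K.faces}.Finite ↔ {v | {v} ∈ L.faces}.Finite := by
  induction h with
  | rel K L h =>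
    rcases h with ⟨A, hA, a, ha, rfl⟩ | ⟨f, hf, rfl⟩
    · constructor <;> intro h
      · refine (h.union (Set.finite_singleton a)).subset fun v hv => ?_
        rcases (mem_faces_starring_iff hA ha).mp hv with h | h
        · exact Or.inl h.2.1
        · exact Or.inr (Finset.mem_singleton.mp h.1).symm
      -- A vertex of `K` can disappear only when `A` consists of that vertex.
      · refine (h.union A.finite_toSet).subset fun v hv => ?_
        by_cases hvA : v ∈ A
        · exact Or.inr hvA
        · refine Or.inl ((mem_faces_starring_iff hA ha).mpr (Or.inl ⟨?_, hv, ?_⟩))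
          · rintro h
            obtain rfl := Finset.mem_singleton.mp h
            exact ha hv
          · intro hAv
            obtain ⟨w, hw⟩ := nonempty_of_mem_faces hA
            exact hvA (Finset.mem_singleton.mp (hAv hw) ▸ hw)
    · have : {v | {v} ∈ (K.map f).faces} = f '' {v | {v} ∈ K.faces} := by
        ext w
        constructor
        · rintro ⟨F, hF, hFw⟩
          obtain ⟨v, hv⟩ := nonempty_of_mem_faces hF
          have : f v ∈ ({w} : Finset ℤ) := hFw ▸ Finset.mem_image_of_mem f hv
          exact ⟨v, singleton_mem_faces hF hv, Finset.mem_singleton.mp this⟩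
        · rintro ⟨v, hv, rfl⟩
          exact ⟨{v}, hv, Finset.image_singleton f v⟩
      rw [this]
      exact (Set.finite_image_iff hf).symm
  | refl K => exact Iff.rfl
  | symm K L _ ih => exact ih.symm
  | trans K L N _ _ ih₁ ih₂ => exact ih₁.trans ih₂

/-- A complex with finitely many vertices is finite. -/
theorem finite_faces_of_finite_vertices {ι : Type*} {K : PreAbstractSimplicialComplex ι}
    (h : {v | {v} ∈ K.faces}.Finite) : K.faces.Finite :=
  (Set.Finite.finite_subsets h).preimage (Finset.coe_injective.injOn) |>.subset fun _ hF _ hv =>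
    singleton_mem_faces hF hv

end Stellar

namespace Stellar

open Set

/-! ### Finite complexes: compactness and barycentric subdivision -/

section Finite

variable {ι : Type*}

/-- Each closed simplex is a closed subset of the cube `[0, 1]^ι`, which is compact even when `ι` is
infinite; there are finitely many simplices. -/
theorem isCompact_realization {K : PreAbstractSimplicialComplex ι} (hK : K.faces.Finite) :
    IsCompact (realization K) := by
  have h : realization K = ⋃ F ∈ K.faces, {x : ι → ℝ | (∀ v, 0 ≤ x v) ∧
      (∀ v, v ∉ F → x v = 0) ∧ ∑ v ∈ F, x v = 1} := by
    ext x
    simp only [realization, Set.mem_ofPred_eq, Set.mem_iUnion, exists_prop]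
    tauto
  rw [h]
  refine hK.isCompact_biUnion fun F _ => ?_
  refine IsCompact.of_isClosed_subset
    (isCompact_univ_pi fun _ : ι => isCompact_Icc (a := (0 : ℝ)) (b := 1)) ?_ ?_
  · have h1 : IsClosed {x : ι → ℝ | ∀ v, 0 ≤ x v} := by
      simp only [Set.ofPred_forall]
      exact isClosed_iInter fun v => isClosed_le continuous_const (continuous_apply v)
    have h2 : IsClosed {x : ι → ℝ | ∀ v, v ∉ F → x v = 0} := by
      simp only [Set.ofPred_forall]
      exact isClosed_iInter fun v => isClosed_iInter fun _ =>
        isClosed_eq (continuous_apply v) continuous_const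
    have h3 : IsClosed {x : ι → ℝ | ∑ v ∈ F, x v = 1} :=
      isClosed_eq (continuous_finsetSum _ fun v _ => continuous_apply v) continuous_const
    exact h1.inter (h2.inter h3)
  · rintro x ⟨h0, hF, hsum⟩ v -
    refine ⟨h0 v, ?_⟩
    by_cases hv : v ∈ F
    · rw [← hsum]
      exact Finset.single_le_sum (fun u _ => h0 u) hv
    · rw [hF v hv]
      exact zero_le_one

theorem exists_greatest_of_isChain {C : Finset (Finset ι)} (hne : C.Nonempty)
    (hC : IsChain (· ⊆ ·) (C : Set (Finset ι))) : ∃ T ∈ C, ∀ F ∈ C, F ⊆ T := by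
  obtain ⟨T, hT, hmax⟩ := C.exists_max_image Finset.card hne
  refine ⟨T, hT, fun F hF => ?_⟩
  rcases hC.total hF hT with h | h
  · exact h
  · exact (Finset.eq_of_subset_of_card_le h (hmax F hF)).symm.subset

theorem finite_faces_barycentricSubdivision {K : PreAbstractSimplicialComplex ι}
    (hK : K.faces.Finite) : (barycentricSubdivision K).faces.Finite := by
  refine finite_faces_of_finite_vertices (hK.subset fun F hF => ?_)
  exact hF.2.1 F (Finset.mem_singleton_self F)

variable [DecidableEq ι]

/-- The indicator functions of a chain of nonempty sets are linearly independent. -/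
theorem eq_zero_of_isChain (D : Finset (Finset ι)) (hne : ∀ F ∈ D, F.Nonempty)
    (hD : IsChain (· ⊆ ·) (D : Set (Finset ι))) (e : Finset ι → ℝ)
    (he : ∀ v, ∑ F ∈ D, (if v ∈ F then e F else 0) = 0) : ∀ F ∈ D, e F = 0 := by
  induction D using Finset.induction_on_max_value (ι := Finset ι) (f := Finset.card) with
  | empty => simp
  | insert T D hT hmax ih =>
    have hsub : ∀ F ∈ D, F ⊂ T := fun F hF => by
      have hFT : F ≠ T := fun h => hT (h ▸ hF)
      rcases hD (Finset.mem_coe.mpr (Finset.mem_insert_of_mem hF))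
        (Finset.mem_coe.mpr (Finset.mem_insert_self _ _)) hFT with h | h
      · exact h.ssubset_of_ne hFT
      · exact absurd (Finset.eq_of_subset_of_card_le h (hmax F hF)).symm hFT
    have hD' : IsChain (· ⊆ ·) (D : Set (Finset ι)) :=
      hD.mono (by simp)
    -- A vertex contained only in the largest member of the chain isolates the coefficient of that
    -- member.
    have hv : ∃ v ∈ T, ∀ F ∈ D, v ∉ F := by
      rcases D.eq_empty_or_nonempty with rfl | hDne
      · obtain ⟨v, hv⟩ := hne T (Finset.mem_insert_self _ _)
        exact ⟨v, hv, by simp⟩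
      · obtain ⟨G, hG, hGmax⟩ := exists_greatest_of_isChain hDne hD'
        obtain ⟨v, hv, hvG⟩ := Finset.exists_of_ssubset (hsub G hG)
        exact ⟨v, hv, fun F hF h => hvG (hGmax F hF h)⟩
    have heT : e T = 0 := by
      obtain ⟨v, hvT, hv⟩ := hv
      have := he v
      rwa [Finset.sum_insert hT, if_pos hvT,
        Finset.sum_eq_zero fun F hF => if_neg (hv F hF), add_zero] at this
    intro F hF
    rcases Finset.mem_insert.mp hF with rfl | hF
    · exact heT
    · refine ih (fun F hF => hne F (Finset.mem_insert_of_mem hF)) hD' (fun v => ?_) F hF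
      have := he v
      rw [Finset.sum_insert hT, heT] at this
      simpa using this

/-- A nonnegative function with finite support is a combination of the indicator functions of a
chain. -/
theorem exists_chain_decomposition (S : Finset ι) : ∀ x : ι → ℝ, (∀ v, v ∈ S → 0 < x v) →
    (∀ v, v ∉ S → x v = 0) → ∃ (C : Finset (Finset ι)) (u : Finset ι → ℝ),
      IsChain (· ⊆ ·) (C : Set (Finset ι)) ∧ (∀ F ∈ C, F.Nonempty ∧ F ⊆ S) ∧
      (∀ F, 0 ≤ u F) ∧ ∀ v, x v = ∑ F ∈ C, if v ∈ F then u F else 0 := by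
  induction S using Finset.strongInduction with
  | H S ih =>
    intro x hpos hzero
    rcases S.eq_empty_or_nonempty with rfl | hS
    · exact ⟨∅, 0, by simp, by simp, by simp, by simpa using hzero⟩
    obtain ⟨v₀, hv₀, hmin⟩ := S.exists_min_image x hS
    -- Removing the minimal value over `S` kills at least `v₀`, so the support shrinks; `S` itself
    -- enters the chain on top with coefficient `x v₀`.
    set x' : ι → ℝ := fun v => if v ∈ S then x v - x v₀ else 0 with hx'
    have hss : (S.filter fun v => 0 < x' v) ⊂ S := by
      refine Finset.filter_ssubset.mpr ⟨v₀, hv₀, ?_⟩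
      simp [hx', hv₀]
    obtain ⟨C, u, hC, hCS, hu, hxu⟩ := ih _ hss x' (fun v hv => (Finset.mem_filter.mp hv).2)
      (fun v hv => by
        by_cases hvS : v ∈ S
        · have h1 : 0 ≤ x' v := by simp only [hx', hvS, if_true]; exact sub_nonneg.mpr (hmin v hvS)
          exact le_antisymm (not_lt.mp fun h => hv (Finset.mem_filter.mpr ⟨hvS, h⟩)) h1
        · simp [hx', hvS])
    have hSC : S ∉ C := fun h => hss.2 (hCS S h).2
    refine ⟨insert S C, Function.update u S (x v₀), ?_, ?_, ?_, ?_⟩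
    · rw [Finset.coe_insert]
      exact hC.insert fun F hF _ => Or.inr ((hCS F hF).2.trans hss.1)
    · intro F hF
      rcases Finset.mem_insert.mp hF with rfl | hF
      · exact ⟨hS, subset_rfl⟩
      · exact ⟨(hCS F hF).1, (hCS F hF).2.trans hss.1⟩
    · intro F
      by_cases hF : F = S
      · rw [hF, Function.update_self]; exact (hpos v₀ hv₀).le
      · rw [Function.update_of_ne hF]; exact hu F
    · intro v
      rw [Finset.sum_insert hSC, Function.update_self]
      have h1 : ∑ F ∈ C, (if v ∈ F then Function.update u S (x v₀) F else 0) = x' v := by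
        rw [hxu v]
        refine Finset.sum_congr rfl fun F hF => ?_
        rw [Function.update_of_ne (ne_of_mem_of_not_mem hF hSC)]
      rw [h1]
      by_cases hv : v ∈ S
      · simp [hx', hv]
      · simp [hx', hv, hzero v hv]

variable {K : PreAbstractSimplicialComplex ι} (hK : K.faces.Finite)

/-- The point of `|K|` with given barycentric coordinates in the barycentric subdivision. -/
noncomputable def barycentricPoint (w : Finset ι → ℝ) (v : ι) : ℝ :=
  ∑ F ∈ hK.toFinset, if v ∈ F then w F / F.card else 0

theorem continuous_barycentricPoint : Continuous (barycentricPoint hK) :=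
  continuous_pi fun v => continuous_finsetSum _ fun F _ => by
    split_ifs <;> fun_prop

theorem barycentricPoint_eq_sum {w : Finset ι → ℝ} {C : Finset (Finset ι)}
    (hC : ∀ F ∈ C, F ∈ K.faces) (hw : ∀ F, F ∉ C → w F = 0) (v : ι) :
    barycentricPoint hK w v = ∑ F ∈ C, if v ∈ F then w F / F.card else 0 := by
  refine (Finset.sum_subset (fun F hF => hK.mem_toFinset.mpr (hC F hF)) fun F _ hF => ?_).symm
  simp [hw F hF]

theorem barycentricPoint_nonneg {w : Finset ι → ℝ} (h0 : ∀ F, 0 ≤ w F) (v : ι) :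
    0 ≤ barycentricPoint hK w v :=
  Finset.sum_nonneg fun F _ => by
    split_ifs
    · exact div_nonneg (h0 F) (Nat.cast_nonneg _)
    · exact le_rfl

theorem sum_barycentricPoint {w : Finset ι → ℝ} {C : Finset (Finset ι)} {T : Finset ι}
    (hC : ∀ F ∈ C, F ∈ K.faces) (hw : ∀ F, F ∉ C → w F = 0) (hT : ∀ F ∈ C, F ⊆ T) :
    ∑ v ∈ T, barycentricPoint hK w v = ∑ F ∈ C, w F := by
  simp only [barycentricPoint_eq_sum hK hC hw]
  rw [Finset.sum_comm]
  refine Finset.sum_congr rfl fun F hF => ?_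
  have hc : (F.card : ℝ) ≠ 0 := by
    exact_mod_cast (nonempty_of_mem_faces (hC F hF)).card_pos.ne'
  rw [Finset.sum_ite_mem, Finset.inter_eq_right.mpr (hT F hF), Finset.sum_const, nsmul_eq_mul,
    mul_div_cancel₀ _ hc]

theorem barycentricPoint_eq_zero {w : Finset ι → ℝ} {v : ι}
    (h : ∀ F, w F ≠ 0 → v ∉ F) : barycentricPoint hK w v = 0 :=
  Finset.sum_eq_zero fun F _ => by
    by_cases hF : w F = 0
    · simp [hF]
    · rw [if_neg (h F hF)]

theorem barycentricPoint_mem {w : Finset ι → ℝ}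
    (hw : w ∈ realization (barycentricSubdivision K)) : barycentricPoint hK w ∈ realization K := by
  obtain ⟨h0, C, ⟨hne, hCK, hC⟩, hCw, hsum⟩ := hw
  obtain ⟨T, hT, hmax⟩ := exists_greatest_of_isChain hne hC
  refine ⟨barycentricPoint_nonneg hK h0, T, hCK T hT, fun v hv => ?_, ?_⟩
  · refine barycentricPoint_eq_zero hK fun F hF hvF => hv (hmax F ?_ hvF)
    by_contra h
    exact hF (hCw F h)
  · rw [sum_barycentricPoint hK hCK hCw hmax, hsum]

/-- A chain member containing `u` is not inside `F`, so it contains `F` and hence `v`; the member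
`F` makes the inequality strict. Every member of the chain is thus a superlevel set of the point. -/
theorem barycentricPoint_lt {w : Finset ι → ℝ}
    (hw : w ∈ realization (barycentricSubdivision K)) {F : Finset ι} (hF : 0 < w F) {u v : ι}
    (hu : u ∉ F) (hv : v ∈ F) : barycentricPoint hK w u < barycentricPoint hK w v := by
  obtain ⟨h0, C, ⟨hne, hCK, hC⟩, hCw, hsum⟩ := hw
  have hmem : ∀ G, w G ≠ 0 → G ∈ C := fun G hG => by
    by_contra h
    exact hG (hCw G h)
  have hFC := hmem F hF.ne'
  rw [barycentricPoint_eq_sum hK hCK hCw, barycentricPoint_eq_sum hK hCK hCw]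
  refine Finset.sum_lt_sum (fun G hG => ?_) ⟨F, hFC, ?_⟩
  · have hnn : 0 ≤ w G / (G.card : ℝ) := div_nonneg (h0 G) (Nat.cast_nonneg _)
    by_cases huG : u ∈ G
    · have hvG : v ∈ G := by
        rcases hC.total hG hFC with h | h
        · exact absurd (h huG) hu
        · exact h hv
      rw [if_pos huG, if_pos hvG]
    · rw [if_neg huG]
      split_ifs
      · exact hnn
      · exact le_rfl
  · rw [if_neg hu, if_pos hv]
    exact div_pos hF (by exact_mod_cast Finset.card_pos.mpr ⟨v, hv⟩)

/-- Incomparable members of the two supporting chains would give opposite strict inequalities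
between two coordinates of the same point. The union of the chains is therefore a chain, and linear
independence of its indicators gives equal weights. -/
theorem barycentricPoint_injOn :
    Set.InjOn (barycentricPoint hK) (realization (barycentricSubdivision K)) := by
  intro w hw w' hw' heq
  obtain ⟨C, ⟨-, hCK, hC⟩, hCw, -⟩ := exists_support_face hw
  obtain ⟨C', ⟨-, hCK', hC'⟩, hCw', -⟩ := exists_support_face hw'
  have hcmp : ∀ F ∈ C, ∀ G ∈ C', F ⊆ G ∨ G ⊆ F := by
    intro F hF G hG
    by_contra! h
    obtain ⟨v, hvF, hvG⟩ := Finset.not_subset.mp h.1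
    obtain ⟨u, huG, huF⟩ := Finset.not_subset.mp h.2
    have h1 := barycentricPoint_lt hK hw ((hCw F).mp hF) huF hvF
    have h2 := barycentricPoint_lt hK hw' ((hCw' G).mp hG) hvG huG
    rw [← heq] at h2
    exact lt_asymm h1 h2
  have hD : IsChain (· ⊆ ·) ((C ∪ C' : Finset (Finset ι)) : Set (Finset ι)) := by
    intro F hF G hG hFG
    rw [Finset.mem_coe, Finset.mem_union] at hF hG
    rcases hF with hF | hF <;> rcases hG with hG | hG
    · exact hC hF hG hFG
    · exact hcmp F hF G hG
    · exact (hcmp G hG F hF).symm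
    · exact hC' hF hG hFG
  have hDK : ∀ F ∈ C ∪ C', F ∈ K.faces := fun F hF =>
    (Finset.mem_union.mp hF).elim (hCK F) (hCK' F)
  have hz : ∀ F, F ∉ C ∪ C' → w F = 0 ∧ w' F = 0 := fun F hF => by
    rw [Finset.mem_union, not_or, hCw, hCw'] at hF
    exact ⟨le_antisymm (not_lt.mp hF.1) (hw.1 F), le_antisymm (not_lt.mp hF.2) (hw'.1 F)⟩
  have h0 := eq_zero_of_isChain (C ∪ C') (fun F hF => nonempty_of_mem_faces (hDK F hF)) hD
    (fun F => (w F - w' F) / F.card) (fun v => by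
      have := congrFun heq v
      rw [barycentricPoint_eq_sum hK hDK fun F hF => (hz F hF).1,
        barycentricPoint_eq_sum hK hDK fun F hF => (hz F hF).2, ← sub_eq_zero,
        ← Finset.sum_sub_distrib] at this
      refine (Finset.sum_congr rfl fun F _ => ?_).trans this
      split_ifs
      · ring
      · ring)
  ext F
  by_cases hF : F ∈ C ∪ C'
  · have hc : (F.card : ℝ) ≠ 0 := by
      exact_mod_cast (nonempty_of_mem_faces (hDK F hF)).card_pos.ne'
    have := h0 F hF
    rw [div_eq_zero_iff, or_iff_left hc] at this
    linarith
  · rw [(hz F hF).1, (hz F hF).2]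

theorem exists_barycentricPoint_eq {x : ι → ℝ} (hx : x ∈ realization K) :
    ∃ w ∈ realization (barycentricSubdivision K), barycentricPoint hK w = x := by
  classical
  obtain ⟨S, hS, hSx, hsum⟩ := exists_support_face hx
  obtain ⟨C, u, hC, hCS, hu, hxu⟩ := exists_chain_decomposition S x (fun v => (hSx v).mp)
    (fun v hv => le_antisymm (not_lt.mp fun h => hv ((hSx v).mpr h)) (hx.1 v))
  have hCK : ∀ F ∈ C, F ∈ K.faces := fun F hF =>
    mem_faces_of_subset hS (hCS F hF).2 (hCS F hF).1
  have hcard : ∀ F ∈ C, (F.card : ℝ) ≠ 0 := fun F hF => by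
    exact_mod_cast (hCS F hF).1.card_pos.ne'
  -- The indicator of `F` is `F.card` times its barycentre.
  let w : Finset ι → ℝ := fun F => if F ∈ C then F.card * u F else 0
  have hw0 : ∀ F, F ∉ C → w F = 0 := fun F hF => if_neg hF
  have hwx : barycentricPoint hK w = x := by
    ext v
    rw [barycentricPoint_eq_sum hK hCK hw0, hxu v]
    refine Finset.sum_congr rfl fun F hF => ?_
    simp only [w, hF, if_true]
    rw [mul_div_cancel_left₀ _ (hcard F hF)]
  have hws : ∑ F ∈ C, w F = 1 := by
    rw [← sum_barycentricPoint hK hCK hw0 fun F hF => (hCS F hF).2, hwx, hsum]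
  refine ⟨w, ⟨fun F => ?_, C, ⟨?_, hCK, hC⟩, hw0, hws⟩, hwx⟩
  · simp only [w]
    split_ifs
    · exact mul_nonneg (Nat.cast_nonneg _) (hu F)
    · exact le_rfl
  · by_contra h
    rw [Finset.not_nonempty_iff_eq_empty] at h
    simp [h] at hws

/-- The barycentric subdivision does not change the realization. -/
noncomputable def barycentricHomeomorph :
    realization (barycentricSubdivision K) ≃ₜ realization K :=
  haveI : CompactSpace (realization (barycentricSubdivision K)) :=
    isCompact_iff_compactSpace.mp
      (isCompact_realization (finite_faces_barycentricSubdivision hK))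
  Continuous.homeoOfEquivCompactToT2
    (f := Equiv.ofBijective
      (fun w => (⟨barycentricPoint hK w.1, barycentricPoint_mem hK w.2⟩ : realization K))
      ⟨fun w w' h => Subtype.ext (barycentricPoint_injOn hK w.2 w'.2 (congrArg Subtype.val h)),
        fun x => by
          obtain ⟨w, hw, h⟩ := exists_barycentricPoint_eq hK x.2
          exact ⟨⟨w, hw⟩, Subtype.ext h⟩⟩)
    (((continuous_barycentricPoint hK).comp continuous_subtype_val).subtype_mk _)

theorem coe_barycentricHomeomorph (w : realization (barycentricSubdivision K)) :
    (barycentricHomeomorph hK w).1 = barycentricPoint hK w.1 := rfl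

end Finite

/-- The realization of the boundary of a simplex. -/
theorem nonempty_homeomorph_simplexBoundary {ι : Type*} (T : Finset ι) :
    Nonempty (simplexSphere T ≃ₜ realization (simplexBoundary T)) := by
  classical
  let φ : (T → ℝ) → ι → ℝ := fun s v => if h : v ∈ T then s ⟨v, h⟩ else 0
  have hφT : ∀ s (v : T), φ s v = s v := fun s v => by simp [φ]
  have hφ : Continuous φ := continuous_pi fun v => by
    by_cases h : v ∈ T
    · simpa only [φ, h, dif_pos] using continuous_apply _
    · simpa only [φ, h, dif_neg, not_false_eq_true] using continuous_const
  have hφsum : ∀ s, ∑ v ∈ T, φ s v = ∑ v, s v := fun s => by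
    rw [← Finset.sum_coe_sort T]
    exact Finset.sum_congr rfl fun v _ => hφT s v
  have hφm : ∀ s ∈ simplexSphere T, φ s ∈ realization (simplexBoundary T) := by
    rintro s ⟨h0, hsum, v₀, hv₀⟩
    have h0' : ∀ v, 0 ≤ φ s v := fun v => by
      by_cases h : v ∈ T
      · simpa only [φ, h, dif_pos] using h0 _
      · simp [φ, h]
    have hs : ∑ v ∈ T.erase v₀, φ s v = 1 := by
      rw [← hsum, ← hφsum, ← Finset.sum_erase_add T _ v₀.2, hφT, hv₀, add_zero]
    refine ⟨h0', T.erase v₀, ⟨?_, Finset.erase_ssubset v₀.2⟩, fun v hv => ?_, hs⟩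
    · by_contra h
      rw [Finset.not_nonempty_iff_eq_empty] at h
      simp [h] at hs
    · by_cases h : v ∈ T
      · have : v = v₀ := by
          by_contra h'
          exact hv (Finset.mem_erase.mpr ⟨h', h⟩)
        rw [this, hφT, hv₀]
      · simp [φ, h]
  have hψm : ∀ x ∈ realization (simplexBoundary T), (fun v : T => x v) ∈ simplexSphere T := by
    rintro x ⟨h0, F, ⟨-, hFT⟩, hFx, hsum⟩
    refine ⟨fun v => h0 v, ?_, ?_⟩
    · rw [Finset.sum_coe_sort T x, ← hsum]
      exact (Finset.sum_subset hFT.1 fun v _ hv => hFx v hv).symm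
    · obtain ⟨v, hv, hvF⟩ := Finset.exists_of_ssubset hFT
      exact ⟨⟨v, hv⟩, hFx v hvF⟩
  refine ⟨⟨⟨fun s => ⟨φ s.1, hφm _ s.2⟩, fun x => ⟨fun v => x.1 v, hψm _ x.2⟩, fun s => ?_,
    fun x => ?_⟩, (hφ.comp continuous_subtype_val).subtype_mk _, ?_⟩⟩
  · ext v
    exact hφT s.1 v
  · ext v
    by_cases h : v ∈ T
    · exact hφT _ ⟨v, h⟩
    · obtain ⟨-, F, ⟨-, hFT⟩, hFx, -⟩ := x.2
      change φ _ v = x.1 v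
      rw [hFx v fun hv => h (hFT.1 hv)]
      simp [φ, h]
  · exact (continuous_pi fun v => (continuous_apply v.1).comp continuous_subtype_val).subtype_mk _

end Stellar

namespace Stellar

open Set

/-! ### The cells of `a ⋆ (S/≃)` -/

namespace RegularEquivalence

variable {S : PreAbstractSimplicialComplex ℤ} (E : RegularEquivalence S)

/-- The vertices of two simplices are equivalent. -/
def Matches (α β : Finset ℤ) : Prop :=
  (∀ v ∈ α, ∃ w ∈ β, E.vertexRel v w) ∧ ∀ w ∈ β, ∃ v ∈ α, E.vertexRel v w

variable {E}

theorem Matches.symm {α β : Finset ℤ} (h : E.Matches α β) : E.Matches β α :=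
  ⟨fun w hw => (h.2 w hw).imp fun _ hv => ⟨hv.1, E.vertexRel.symm hv.2⟩,
    fun v hv => (h.1 v hv).imp fun _ hw => ⟨hw.1, E.vertexRel.symm hw.2⟩⟩

theorem Matches.trans {α β γ : Finset ℤ} (h : E.Matches α β) (h' : E.Matches β γ) :
    E.Matches α γ := by
  refine ⟨fun v hv => ?_, fun u hu => ?_⟩
  · obtain ⟨w, hw, hvw⟩ := h.1 v hv
    obtain ⟨u, hu, hwu⟩ := h'.1 w hw
    exact ⟨u, hu, E.vertexRel.trans hvw hwu⟩
  · obtain ⟨w, hw, hwu⟩ := h'.2 u hu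
    obtain ⟨v, hv, hvw⟩ := h.2 w hw
    exact ⟨v, hv, E.vertexRel.trans hvw hwu⟩

/-- Matching of vertices composes along chains of elementary gluings, whereas the generators that
witness the individual gluings may change at every link. -/
theorem matches_of_eqvGen {α β : Finset ℤ} (h : Relation.EqvGen E.FaceGlue α β) :
    E.Matches α β := by
  induction h with
  | rel α β h =>
    rcases h with ⟨g, p, -, -, -, -, -, h⟩ | ⟨v, w, -, -, h, rfl, rfl⟩
    · exact h
    · simpa [Matches] using h
  | refl α => exact ⟨fun v hv => ⟨v, hv, E.vertexRel.refl v⟩, fun v hv => ⟨v, hv, E.vertexRel.refl v⟩⟩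
  | symm α β _ ih => exact ih.symm
  | trans α β γ _ _ ih₁ ih₂ => exact ih₁.trans ih₂

theorem mem_faces_iff_of_eqvGen {α β : Finset ℤ} (h : Relation.EqvGen E.FaceGlue α β) :
    α ∈ S.faces ↔ β ∈ S.faces := by
  induction h with
  | rel α β h =>
    rcases h with ⟨g, p, hg, hp, -, hα, hβ, h⟩ | ⟨v, w, hv, hw, h, rfl, rfl⟩
    · constructor <;> intro hF
      · obtain ⟨v, hv⟩ := nonempty_of_mem_faces hF
        obtain ⟨w, hw, -⟩ := h.1 v hv
        exact mem_faces_of_subset hp.1 hβ ⟨w, hw⟩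
      · obtain ⟨w, hw⟩ := nonempty_of_mem_faces hF
        obtain ⟨v, hv, -⟩ := h.2 w hw
        exact mem_faces_of_subset hg.1 hα ⟨v, hv⟩
    · exact iff_of_true hv hw
  | refl α => exact Iff.rfl
  | symm α β _ ih => exact ih.symm
  | trans α β γ _ _ ih₁ ih₂ => exact ih₁.trans ih₂

theorem eq_or_notMem_of_eqvGen {a : ℤ} (ha : {a} ∉ S.faces) {α β : Finset ℤ}
    (h : Relation.EqvGen E.FaceGlue α β) : α = β ∨ (a ∉ α ∧ a ∉ β) := by
  induction h with
  | rel α β h =>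
    right
    rcases h with ⟨g, p, hg, hp, -, hα, hβ, -⟩ | ⟨v, w, hv, hw, h, rfl, rfl⟩
    · exact ⟨fun h => ha (singleton_mem_faces hg.1 (hα h)),
        fun h => ha (singleton_mem_faces hp.1 (hβ h))⟩
    · exact ⟨fun h => ha (Finset.mem_singleton.mp h ▸ hv),
        fun h => ha (Finset.mem_singleton.mp h ▸ hw)⟩
  | refl α => exact Or.inl rfl
  | symm α β _ ih => exact ih.imp Eq.symm And.symm
  | trans α β γ _ _ ih₁ ih₂ =>
    rcases ih₁ with rfl | h₁
    · exact ih₂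
    · rcases ih₂ with rfl | h₂
      · exact Or.inr h₁
      · exact Or.inr ⟨h₁.1, h₂.2⟩

variable (hS : S.faces.Finite)
include hS

/-- By finiteness every simplex lies in a generator, so the first regularity condition passes to all
simplices. -/
theorem eq_of_vertexRel {α : Finset ℤ} (hα : α ∈ S.faces) {v w : ℤ} (hv : v ∈ α) (hw : w ∈ α)
    (h : E.vertexRel v w) : v = w := by
  obtain ⟨g, hg, hmax⟩ := hS.exists_le_maximal hα
  exact E.vertex_injective g hmax v (hg hv) w (hg hw) h

theorem Matches.eq_of_subset {α β γ : Finset ℤ} (h : E.Matches α β) (hγ : γ ∈ S.faces)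
    (hα : α ⊆ γ) (hβ : β ⊆ γ) : α = β := by
  ext v
  constructor
  · intro hv
    obtain ⟨w, hw, hvw⟩ := h.1 v hv
    rwa [eq_of_vertexRel hS hγ (hα hv) (hβ hw) hvw]
  · intro hv
    obtain ⟨w, hw, hvw⟩ := h.2 v hv
    rwa [← eq_of_vertexRel hS hγ (hα hw) (hβ hv) hvw]

theorem Matches.card_le {α β : Finset ℤ} (h : E.Matches α β) (hα : α ∈ S.faces) :
    α.card ≤ β.card := by
  choose f hf hrel using h.1
  refine Finset.card_le_card_of_injOn (fun v => if hv : v ∈ α then f v hv else v) ?_ ?_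
  · intro v hv
    have hv' : v ∈ α := hv
    simpa [hv'] using hf v hv'
  · intro v hv w hw hvw
    have hv' : v ∈ α := hv
    have hw' : w ∈ α := hw
    simp only [hv', hw', dif_pos] at hvw
    exact eq_of_vertexRel hS hα hv' hw'
      (E.vertexRel.trans (hrel v hv') (hvw ▸ E.vertexRel.symm (hrel w hw')))

theorem Matches.card_eq {α β : Finset ℤ} (h : E.Matches α β) (hα : α ∈ S.faces)
    (hβ : β ∈ S.faces) : α.card = β.card :=
  le_antisymm (h.card_le hS hα) (h.symm.card_le hS hβ)

/-- Barycentric coordinates can be transported along matching simplices. -/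
theorem Matches.exists_transport {α β : Finset ℤ} (h : E.Matches α β) (hα : α ∈ S.faces)
    (hβ : β ∈ S.faces) (x : realization S) (hx : ∀ v, v ∉ α → x.1 v = 0) :
    ∃ y : realization S, (∀ w, w ∉ β → y.1 w = 0) ∧
      ∀ v ∈ α, ∀ w ∈ β, E.vertexRel v w → x.1 v = y.1 w := by
  choose! f hf hrel using h.2
  have hfw : ∀ v ∈ α, ∀ w ∈ β, E.vertexRel v w → f w = v := fun v hv w hw hvw =>
    eq_of_vertexRel hS hα (hf w hw) hv (E.vertexRel.trans (hrel w hw) (E.vertexRel.symm hvw))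
  refine ⟨⟨fun w => if w ∈ β then x.1 (f w) else 0, fun w => ?_, β, hβ, fun w hw => if_neg hw, ?_⟩,
    fun w hw => if_neg hw, fun v hv w hw hvw => ?_⟩
  · dsimp only
    split_ifs
    · exact x.2.1 _
    · exact le_rfl
  · obtain ⟨-, F, hF, hFx, hsum⟩ := x.2
    have h1 : ∑ v ∈ α, x.1 v = 1 := by
      have h2 : ∑ v ∈ α, x.1 v = ∑ v ∈ α ∪ F, x.1 v :=
        Finset.sum_subset Finset.subset_union_left fun v _ hv => hx v hv
      have h3 : ∑ v ∈ F, x.1 v = ∑ v ∈ α ∪ F, x.1 v :=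
        Finset.sum_subset Finset.subset_union_right fun v _ hv => hFx v hv
      rw [h2, ← h3, hsum]
    rw [← h1]
    refine Finset.sum_nbij f hf (fun w hw w' hw' hww => ?_) (fun v hv => ?_) fun w hw => if_pos hw
    · refine eq_of_vertexRel hS hβ hw hw' (E.vertexRel.trans (E.vertexRel.symm (hrel w hw)) ?_)
      rw [hww]
      exact hrel w' hw'
    · obtain ⟨w, hw, hvw⟩ := h.1 v hv
      exact ⟨w, hw, hfw v hv w hw hvw⟩
  · change x.1 v = if w ∈ β then x.1 (f w) else 0
    rw [if_pos hw, hfw v hv w hw hvw]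

/-- Points of identified simplices with equal barycentric coordinates are identified. -/
theorem mk_eq_mk_of_eqvGen {α β : Finset ℤ} (h : Relation.EqvGen E.FaceGlue α β)
    (hα : α ∈ S.faces) : ∀ x y : realization S, (∀ v, v ∉ α → x.1 v = 0) →
      (∀ w, w ∉ β → y.1 w = 0) → (∀ v ∈ α, ∀ w ∈ β, E.vertexRel v w → x.1 v = y.1 w) →
      Quot.mk E.PointGlue x = Quot.mk E.PointGlue y := by
  induction h with
  | rel α β h =>
    intro x y hx hy hxy
    refine Quot.sound ?_
    rcases h with ⟨g, p, hg, hp, hgp, hαg, hβp, h⟩ | ⟨v, w, hv, hw, h, rfl, rfl⟩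
    · refine Or.inl ⟨g, p, hg, hp, hgp, fun v hv => hx v fun h => hv (hαg h),
        fun w hw => hy w fun h => hw (hβp h), fun v hv w hw hvw => ?_⟩
      -- A vertex of `g` outside `α` is equivalent to no vertex of `β`, so both coordinates vanish.
      by_cases hvα : v ∈ α
      · obtain ⟨w', hw', hvw'⟩ := h.1 v hvα
        obtain rfl : w' = w := E.vertex_injective p hp w' (hβp hw') w hw
          (E.vertexRel.trans (E.vertexRel.symm hvw') hvw)
        exact hxy v hvα w' hw' hvw
      · rw [hx v hvα, hy w]
        intro hwβ
        obtain ⟨v', hv', hvw'⟩ := h.2 w hwβ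
        obtain rfl : v' = v := E.vertex_injective g hg v' (hαg hv') v hv
          (E.vertexRel.trans hvw' (E.vertexRel.symm hvw))
        exact hvα hv'
    · have key : ∀ (u : ℤ) (z : realization S), (∀ v, v ∉ ({u} : Finset ℤ) → z.1 v = 0) →
          z.1 = Pi.single u 1 := by
        intro u z hz
        obtain ⟨F, hF, hFz, hsum⟩ := exists_support_face z.2
        have hFu : F ⊆ {u} := fun v hv => by
          by_contra h
          exact ((hFz v).mp hv).ne' (hz v h)
        have hFu' : F = {u} :=
          ((Finset.subset_singleton_iff.mp hFu).resolve_left (nonempty_of_mem_faces hF).ne_empty)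
        rw [hFu', Finset.sum_singleton] at hsum
        ext v
        by_cases hv : v = u
        · rw [hv, hsum, Pi.single_eq_same]
        · rw [hz v (by simpa using hv), Pi.single_eq_of_ne hv]
      exact Or.inr ⟨v, w, h, key v x hx, key w y hy⟩
  | refl α =>
    intro x y hx hy hxy
    congr 1
    ext v
    by_cases hv : v ∈ α
    · exact hxy v hv v hv (E.vertexRel.refl v)
    · rw [hx v hv, hy v hv]
  | symm α β h ih =>
    intro x y hx hy hxy
    exact (ih ((mem_faces_iff_of_eqvGen h).mpr hα) y x hy hx fun v hv w hw hvw =>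
      (hxy w hw v hv (E.vertexRel.symm hvw)).symm).symm
  | trans α β γ h₁ h₂ ih₁ ih₂ =>
    intro x z hx hz hxz
    have hβ := (mem_faces_iff_of_eqvGen h₁).mp hα
    -- The intermediate simplex carries no given point; transporting `x` supplies one to which both
    -- induction hypotheses apply.
    obtain ⟨y, hy, hxy⟩ := (matches_of_eqvGen h₁).exists_transport hS hα hβ x hx
    refine (ih₁ hα x y hx hy hxy).trans (ih₂ hβ y z hy hz fun w hw u hu hwu => ?_)
    obtain ⟨v, hv, hvw⟩ := (matches_of_eqvGen h₁).2 w hw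
    rw [← hxy v hv w hw hvw]
    exact hxz v hv u hu (E.vertexRel.trans hvw hwu)

end RegularEquivalence

end Stellar

namespace Stellar

open Set

/-! ### The cone parametrization of the derived structure -/

section Pushforward

variable {α β γ : Type*}

open Classical in
/-- The push-forward along `f` of a weight on a finite set. -/
noncomputable def pushforward (C : Finset α) (f : α → β) (w : α → ℝ) (b : β) : ℝ :=
  ∑ x ∈ C, if f x = b then w x else 0

theorem pushforward_nonneg {C : Finset α} {f : α → β} {w : α → ℝ} (hw : ∀ x, 0 ≤ w x) (b : β) :
    0 ≤ pushforward C f w b :=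
  Finset.sum_nonneg fun x _ => by
    split_ifs
    · exact hw x
    · exact le_rfl

theorem pushforward_eq_zero {C : Finset α} {f : α → β} {w : α → ℝ} {b : β}
    (hb : ∀ x ∈ C, f x ≠ b) : pushforward C f w b = 0 :=
  Finset.sum_eq_zero fun x hx => if_neg (hb x hx)

theorem pushforward_subset {C D : Finset α} {f : α → β} {w : α → ℝ} (hCD : C ⊆ D)
    (hw : ∀ x, x ∉ C → w x = 0) : pushforward D f w = pushforward C f w := by
  ext b
  refine (Finset.sum_subset hCD fun x _ hx => ?_).symm
  simp [hw x hx]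

theorem pushforward_apply {C : Finset α} {f : α → β} {w : α → ℝ} (hf : Set.InjOn f C)
    {x : α} (hx : x ∈ C) : pushforward C f w (f x) = w x := by
  rw [pushforward, Finset.sum_eq_single x, if_pos rfl]
  · exact fun y hy hyx => if_neg fun h => hyx (hf hy hx h)
  · exact fun h => absurd hx h

theorem sum_pushforward {C : Finset α} {D : Finset β} {f : α → β} {w : α → ℝ}
    (hf : ∀ x ∈ C, f x ∈ D) (φ : β → ℝ) :
    ∑ b ∈ D, φ b * pushforward C f w b = ∑ x ∈ C, φ (f x) * w x := by
  simp only [pushforward, Finset.mul_sum]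
  rw [Finset.sum_comm]
  refine Finset.sum_congr rfl fun x hx => ?_
  rw [Finset.sum_eq_single (f x), if_pos rfl]
  · intro b _ hb
    rw [if_neg hb.symm, mul_zero]
  · exact fun h => absurd (hf x hx) h

theorem pushforward_pushforward {C : Finset α} {D : Finset β} {f : α → β} {g : β → γ} {w : α → ℝ}
    (hf : ∀ x ∈ C, f x ∈ D) :
    pushforward D g (pushforward C f w) = pushforward C (g ∘ f) w := by
  classical
  ext c
  have := sum_pushforward (w := w) hf fun b => if g b = c then 1 else 0
  simpa [pushforward] using this

end Pushforward

/-- The cone on a complex. -/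
abbrev cone (a : ℤ) (S : PreAbstractSimplicialComplex ℤ) : PreAbstractSimplicialComplex ℤ :=
  join (simplex {a}) S

/-! ### Radial coordinates on the cone -/

section Cone

variable {S : PreAbstractSimplicialComplex ℤ} {a : ℤ}

theorem mem_faces_cone_iff (ha : {a} ∉ S.faces) {F : Finset ℤ} :
    F ∈ (cone a S).faces ↔ F.Nonempty ∧ (F.erase a = ∅ ∨ F.erase a ∈ S.faces) := by
  have hav : ∀ G, (G = ∅ ∨ G ∈ S.faces) → a ∉ G := by
    rintro G (rfl | hG) h
    · simp at h
    · exact ha (singleton_mem_faces hG h)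
  constructor
  · rintro ⟨hne, P, Q, hP, hQ, rfl⟩
    refine ⟨hne, ?_⟩
    have hPa : P ⊆ {a} := by
      rcases hP with rfl | hP
      · simp
      · exact hP.2
    have : (P ∪ Q).erase a = Q := by
      ext v
      simp only [Finset.mem_erase, Finset.mem_union]
      constructor
      · rintro ⟨hva, hv | hv⟩
        · exact absurd (Finset.mem_singleton.mp (hPa hv)) hva
        · exact hv
      · exact fun hv => ⟨fun h => hav Q hQ (h ▸ hv), Or.inr hv⟩
    rwa [this]
  · rintro ⟨hne, hF⟩
    refine ⟨hne, F ∩ {a}, F.erase a, ?_, hF, ?_⟩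
    · rcases (F ∩ {a}).eq_empty_or_nonempty with h | h
      · exact Or.inl h
      · exact Or.inr ⟨h, Finset.inter_subset_right⟩
    · ext v
      simp only [Finset.mem_union, Finset.mem_inter, Finset.mem_singleton, Finset.mem_erase]
      tauto

theorem mem_faces_of_mem_faces_cone (ha : {a} ∉ S.faces) {F : Finset ℤ}
    (hF : F ∈ (cone a S).faces) (haF : a ∉ F) : F ∈ S.faces := by
  have := (mem_faces_cone_iff ha).mp hF
  rw [Finset.erase_eq_of_notMem haF] at this
  exact this.2.resolve_left this.1.ne_empty

theorem mem_faces_cone_of_mem_faces {F : Finset ℤ} (hF : F ∈ S.faces) : F ∈ (cone a S).faces :=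
  ⟨nonempty_of_mem_faces hF, ∅, F, Or.inl rfl, Or.inr hF, (Finset.empty_union F).symm⟩

theorem finite_faces_cone (hS : S.faces.Finite) (ha : {a} ∉ S.faces) :
    (cone a S).faces.Finite := by
  refine finite_faces_of_finite_vertices ?_
  have : {v | {v} ∈ S.faces}.Finite :=
    hS.preimage fun v _ w _ h => Finset.singleton_injective h
  refine (this.union (Set.finite_singleton a)).subset fun v hv => ?_
  by_cases hva : v = a
  · exact Or.inr hva
  · exact Or.inl (mem_faces_of_mem_faces_cone ha hv (by simpa using Ne.symm hva))

theorem apply_eq_zero_of_mem_realization (ha : {a} ∉ S.faces) (s : realization S) : s.1 a = 0 := by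
  obtain ⟨-, F, hF, hFs, -⟩ := s.2
  exact hFs a fun h => ha (singleton_mem_faces hF h)

theorem realization_subset_cone : realization S ⊆ realization (cone a S) := by
  rintro x ⟨h0, F, hF, h⟩
  exact ⟨h0, F, mem_faces_cone_of_mem_faces hF, h⟩

/-- The point of the cone at relative height `t` over a point of the base. -/
def conePoint (a : ℤ) (x : ℤ → ℝ) (t : ℝ) (v : ℤ) : ℝ :=
  if v = a then 1 - t else t * x v

theorem conePoint_mem (ha : {a} ∉ S.faces) (s : realization S) {t : ℝ} (ht : 0 ≤ t)
    (ht' : t ≤ 1) : conePoint a s.1 t ∈ realization (cone a S) := by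
  obtain ⟨h0, F, hF, hFs, hsum⟩ := s.2
  have haF : a ∉ F := fun h => ha (singleton_mem_faces hF h)
  refine ⟨fun v => ?_, insert a F, ?_, fun v hv => ?_, ?_⟩
  · simp only [conePoint]
    split_ifs
    · linarith
    · exact mul_nonneg ht (h0 v)
  · refine (mem_faces_cone_iff ha).mpr ⟨Finset.insert_nonempty _ _, Or.inr ?_⟩
    rwa [Finset.erase_insert haF]
  · rw [Finset.mem_insert, not_or] at hv
    rw [conePoint, if_neg hv.1, hFs v hv.2, mul_zero]
  · rw [Finset.sum_insert haF, conePoint, if_pos rfl]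
    have : ∑ v ∈ F, conePoint a s.1 t v = ∑ v ∈ F, t * s.1 v :=
      Finset.sum_congr rfl fun v hv => if_neg fun (h : v = a) => haF (h ▸ hv)
    rw [this, ← Finset.mul_sum, hsum]
    ring

theorem conePoint_one (ha : {a} ∉ S.faces) (s : realization S) : conePoint a s.1 1 = s.1 := by
  ext v
  by_cases hv : v = a
  · simp [conePoint, hv, apply_eq_zero_of_mem_realization ha s]
  · simp [conePoint, hv]

theorem conePoint_injective (ha : {a} ∉ S.faces) {s s' : realization S} {t : ℝ} (ht : 0 < t)
    (h : conePoint a s.1 t = conePoint a s'.1 t) : s = s' := by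
  ext v
  by_cases hv : v = a
  · rw [hv, apply_eq_zero_of_mem_realization ha, apply_eq_zero_of_mem_realization ha]
  · have := congrFun h v
    simpa [conePoint, hv, ht.ne'] using this

theorem exists_conePoint_eq (ha : {a} ∉ S.faces) (s₀ : realization S) {x : ℤ → ℝ}
    (hx : x ∈ realization (cone a S)) :
    ∃ (s : realization S) (t : ℝ), 0 ≤ t ∧ t ≤ 1 ∧ conePoint a s.1 t = x := by
  obtain ⟨h0, F, hF, hFx, hsum⟩ := hx
  have hsum' : x a + ∑ v ∈ F.erase a, x v = 1 := by
    rw [← hsum]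
    by_cases haF : a ∈ F
    · exact Finset.add_sum_erase F x haF
    · rw [Finset.erase_eq_of_notMem haF, hFx a haF, zero_add]
  have hnn : 0 ≤ ∑ v ∈ F.erase a, x v := Finset.sum_nonneg fun v _ => h0 v
  rcases hnn.eq_or_lt with hz | hpos
  · refine ⟨s₀, 0, le_rfl, zero_le_one, ?_⟩
    ext v
    by_cases hv : v = a
    · simp only [conePoint, hv, if_true]; linarith
    · simp only [conePoint, hv, if_false, zero_mul]
      by_cases hvF : v ∈ F
      · exact ((Finset.sum_eq_zero_iff_of_nonneg fun v _ => h0 v).mp hz.symm v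
          (Finset.mem_erase.mpr ⟨hv, hvF⟩)).symm
      · exact (hFx v hvF).symm
  · have hFS : F.erase a ∈ S.faces := by
      refine ((mem_faces_cone_iff ha).mp hF).2.resolve_left fun h => ?_
      simp [h] at hpos
    set t := ∑ v ∈ F.erase a, x v with ht
    refine ⟨⟨fun v => if v = a then 0 else x v / t, fun v => ?_, F.erase a, hFS, fun v hv => ?_,
      ?_⟩, t, hpos.le, by linarith [h0 a], ?_⟩
    · dsimp only
      split_ifs
      · exact le_rfl
      · exact div_nonneg (h0 v) hpos.le
    · dsimp only
      split_ifs with hva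
      · rfl
      · rw [hFx v fun h => hv (Finset.mem_erase.mpr ⟨hva, h⟩), zero_div]
    · rw [Finset.sum_congr rfl fun v hv => if_neg (Finset.ne_of_mem_erase hv), ← Finset.sum_div,
        ← ht, div_self hpos.ne']
    · ext v
      by_cases hv : v = a
      · simp only [conePoint, hv, if_true]; linarith
      · simp only [conePoint, hv, if_false]
        field_simp

end Cone

/-! ### Weights on chains of cells and the fibres of the gluing map -/

namespace RegularEquivalence

variable {S : PreAbstractSimplicialComplex ℤ} (E : RegularEquivalence S) {a : ℤ}

theorem eqvGen_of_mk_eq {α β : Finset ℤ} (h : Quot.mk E.FaceGlue α = Quot.mk E.FaceGlue β) :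
    Relation.EqvGen E.FaceGlue α β :=
  Quot.eqvGen_exact h

variable (hS : S.faces.Finite) (ha : {a} ∉ S.faces)
include hS ha

/-- The simplices of a chain represent different cells. -/
theorem injOn_mk_of_isChain {C : Finset (Finset ℤ)} (hCK : ∀ F ∈ C, F ∈ (cone a S).faces)
    (hC : IsChain (· ⊆ ·) (C : Set (Finset ℤ))) : Set.InjOn (Quot.mk E.FaceGlue) C := by
  intro F hF G hG h
  have h' := E.eqvGen_of_mk_eq h
  rcases eq_or_notMem_of_eqvGen ha h' with h1 | ⟨haF, haG⟩
  · exact h1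
  rcases hC.total hF hG with hFG | hGF
  · exact (matches_of_eqvGen h').eq_of_subset hS (mem_faces_of_mem_faces_cone ha (hCK G hG) haG)
      hFG subset_rfl
  · exact (matches_of_eqvGen h').eq_of_subset hS (mem_faces_of_mem_faces_cone ha (hCK F hF) haF)
      subset_rfl hGF

/-- The map from the barycentric subdivision of the cone to the derived structure. -/
noncomputable def glueWeights (a : ℤ) (hS : S.faces.Finite) (ha : {a} ∉ S.faces)
    (w : Finset ℤ → ℝ) : E.Cell → ℝ :=
  pushforward (finite_faces_cone hS ha).toFinset (Quot.mk E.FaceGlue) w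

theorem continuous_glueWeights : Continuous (E.glueWeights a hS ha) :=
  continuous_pi fun c => continuous_finsetSum _ fun F _ => by
    split_ifs <;> fun_prop

theorem glueWeights_eq {w : Finset ℤ → ℝ} {C : Finset (Finset ℤ)}
    (hCK : ∀ F ∈ C, F ∈ (cone a S).faces) (hw : ∀ F, F ∉ C → w F = 0) :
    E.glueWeights a hS ha w = pushforward C (Quot.mk E.FaceGlue) w :=
  pushforward_subset (fun F hF => (finite_faces_cone hS ha).mem_toFinset.mpr (hCK F hF)) hw

theorem glueWeights_mem {w : Finset ℤ → ℝ}
    (hw : w ∈ realization (barycentricSubdivision (cone a S))) :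
    E.glueWeights a hS ha w ∈ realization (derivedStructure a E) := by
  classical
  obtain ⟨h0, C, hC, hCw, hsum⟩ := hw
  refine ⟨pushforward_nonneg h0, C.image (Quot.mk E.FaceGlue), ⟨C, hC, rfl⟩, fun c hc => ?_, ?_⟩
  · rw [E.glueWeights_eq hS ha hC.2.1 hCw]
    exact pushforward_eq_zero fun F hF h => hc (h ▸ Finset.mem_image_of_mem _ hF)
  · rw [E.glueWeights_eq hS ha hC.2.1 hCw]
    have := sum_pushforward (w := w) (f := Quot.mk E.FaceGlue)
      (fun F hF => Finset.mem_image_of_mem (s := C) _ hF) fun _ => 1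
    simpa [hsum] using this

/-- A simplex of the derived structure is the injective image of a chain, so its weights lift to
that chain. -/
theorem exists_glueWeights_eq {d : E.Cell → ℝ} (hd : d ∈ realization (derivedStructure a E)) :
    ∃ w ∈ realization (barycentricSubdivision (cone a S)), E.glueWeights a hS ha w = d := by
  classical
  obtain ⟨h0, _, ⟨C, hC, rfl⟩, hCd, hsum⟩ := hd
  have hinj := E.injOn_mk_of_isChain hS ha hC.2.1 hC.2.2
  let w : Finset ℤ → ℝ := fun F => if F ∈ C then d (Quot.mk E.FaceGlue F) else 0
  have hw : ∀ F, F ∉ C → w F = 0 := fun F hF => if_neg hF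
  have hw' : ∀ F ∈ C, w F = d (Quot.mk E.FaceGlue F) := fun F hF => if_pos hF
  refine ⟨w, ⟨fun F => ?_, C, hC, hw, ?_⟩, ?_⟩
  · simp only [w]
    split_ifs
    · exact h0 _
    · exact le_rfl
  · rw [← hsum, Finset.sum_congr rfl hw']
    exact (Finset.sum_image hinj).symm
  · rw [E.glueWeights_eq hS ha hC.2.1 hw]
    ext c
    by_cases hc : c ∈ C.image (Quot.mk E.FaceGlue)
    · obtain ⟨F, hF, rfl⟩ := Finset.mem_image.mp hc
      rw [pushforward_apply hinj hF, hw' F hF]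
    · rw [hCd c hc]
      exact pushforward_eq_zero fun F hF h => hc (h ▸ Finset.mem_image_of_mem _ hF)

/-- Distinct members of a chain give distinct cells, so the weight of a cell is the weight of its
unique representative. A positive weight must then have an equally weighted representative on the
other side. -/
theorem exists_eqvGen_of_glueWeights_eq {w w' : Finset ℤ → ℝ} {C C' : Finset (Finset ℤ)}
    (hC : C ∈ (barycentricSubdivision (cone a S)).faces)
    (hC' : C' ∈ (barycentricSubdivision (cone a S)).faces)
    (hw : ∀ F, F ∈ C ↔ 0 < w F) (hw0 : ∀ F, 0 ≤ w F) (hw' : ∀ F, F ∈ C' ↔ 0 < w' F)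
    (hw0' : ∀ F, 0 ≤ w' F) (h : E.glueWeights a hS ha w = E.glueWeights a hS ha w')
    {F : Finset ℤ} (hF : F ∈ C) : ∃ F' ∈ C', Relation.EqvGen E.FaceGlue F F' ∧ w F = w' F' := by
  have hz : ∀ F, F ∉ C → w F = 0 := fun F hF =>
    le_antisymm (not_lt.mp fun h => hF ((hw F).mpr h)) (hw0 F)
  have hz' : ∀ F, F ∉ C' → w' F = 0 := fun F hF =>
    le_antisymm (not_lt.mp fun h => hF ((hw' F).mpr h)) (hw0' F)
  rw [E.glueWeights_eq hS ha hC.2.1 hz, E.glueWeights_eq hS ha hC'.2.1 hz'] at h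
  have h1 := congrFun h (Quot.mk _ F)
  rw [pushforward_apply (E.injOn_mk_of_isChain hS ha hC.2.1 hC.2.2) hF] at h1
  have h2 : ∃ F' ∈ C', Quot.mk E.FaceGlue F' = Quot.mk E.FaceGlue F := by
    by_contra! h3
    rw [pushforward_eq_zero h3] at h1
    exact ((hw F).mp hF).ne' h1
  obtain ⟨F', hF', hFF'⟩ := h2
  rw [← hFF', pushforward_apply (E.injOn_mk_of_isChain hS ha hC'.2.1 hC'.2.2) hF'] at h1
  exact ⟨F', hF', E.eqvGen_of_mk_eq hFF'.symm, h1⟩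

/-- The derived structure remembers the points outside the base. -/
theorem eq_of_glueWeights_eq {w w' : Finset ℤ → ℝ}
    (hw : w ∈ realization (barycentricSubdivision (cone a S)))
    (hw' : w' ∈ realization (barycentricSubdivision (cone a S)))
    (h : E.glueWeights a hS ha w = E.glueWeights a hS ha w')
    {G : Finset ℤ} (hG : 0 < w G) (haG : a ∈ G) : w = w' := by
  obtain ⟨C, hC, hCw, -⟩ := exists_support_face hw
  obtain ⟨C', hC', hCw', -⟩ := exists_support_face hw'
  have key : ∀ F ∈ C, F ∈ C' ∧ w F = w' F := by
    have hGC := (hCw G).mpr hG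
    obtain ⟨G', hG', hGG', -⟩ :=
      E.exists_eqvGen_of_glueWeights_eq hS ha hC hC' hCw hw.1 hCw' hw'.1 h hGC
    have hG1 : G ∈ C' := by
      rcases eq_or_notMem_of_eqvGen ha hGG' with rfl | h1
      · exact hG'
      · exact absurd haG h1.1
    intro F hF
    obtain ⟨F', hF', hFF', hww⟩ :=
      E.exists_eqvGen_of_glueWeights_eq hS ha hC hC' hCw hw.1 hCw' hw'.1 h hF
    have : F = F' := by
      -- Both chains contain `G`, and simplices without `a` lie below it. Hence `F` and `F'` are
      -- matching faces of the single simplex `G.erase a` of `S`, and so coincide.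
      rcases eq_or_notMem_of_eqvGen ha hFF' with h1 | ⟨haF, haF'⟩
      · exact h1
      have hFG : F ⊆ G := (hC.2.2.total hF hGC).resolve_right fun h => haF (h haG)
      have hFG' : F' ⊆ G := (hC'.2.2.total hF' hG1).resolve_right fun h => haF' (h haG)
      have hFe : F ⊆ G.erase a := Finset.subset_erase.mpr ⟨hFG, haF⟩
      have hne := (nonempty_of_mem_faces (hC.2.1 F hF)).mono hFe
      exact (matches_of_eqvGen hFF').eq_of_subset hS
        (((mem_faces_cone_iff ha).mp (hC.2.1 G hGC)).2.resolve_left hne.ne_empty)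
        hFe (Finset.subset_erase.mpr ⟨hFG', haF'⟩)
    subst this
    exact ⟨hF', hww⟩
  have key' : ∀ F ∈ C', F ∈ C := fun F hF => by
    obtain ⟨F', hF', hFF', -⟩ :=
      E.exists_eqvGen_of_glueWeights_eq hS ha hC' hC hCw' hw'.1 hCw hw.1 h.symm hF
    have := E.injOn_mk_of_isChain hS ha hC'.2.1 hC'.2.2 hF (key F' hF').1 (Quot.eqvGen_sound hFF')
    rwa [this]
  ext F
  by_cases hF : F ∈ C
  · exact (key F hF).2
  · have h1 : ¬ 0 < w F := fun h => hF ((hCw F).mpr h)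
    have h2 : ¬ 0 < w' F := fun h => hF (key' F ((hCw' F).mpr h))
    rw [le_antisymm (not_lt.mp h1) (hw.1 F), le_antisymm (not_lt.mp h2) (hw'.1 F)]

/-- Points of the base with the same image in the derived structure are identified. -/
theorem mk_eq_mk_of_glueWeights_eq {w w' : Finset ℤ → ℝ}
    (hw : w ∈ realization (barycentricSubdivision (cone a S)))
    (hw' : w' ∈ realization (barycentricSubdivision (cone a S)))
    (h : E.glueWeights a hS ha w = E.glueWeights a hS ha w')
    (haw : ∀ F, 0 < w F → a ∉ F) (haw' : ∀ F, 0 < w' F → a ∉ F) {s s' : realization S}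
    (hs : s.1 = barycentricPoint (finite_faces_cone hS ha) w)
    (hs' : s'.1 = barycentricPoint (finite_faces_cone hS ha) w') :
    Quot.mk E.PointGlue s = Quot.mk E.PointGlue s' := by
  classical
  obtain ⟨C, hC, hCw, -⟩ := exists_support_face hw
  obtain ⟨C', hC', hCw', -⟩ := exists_support_face hw'
  have hz : ∀ F, F ∉ C → w F = 0 := fun F hF =>
    le_antisymm (not_lt.mp fun h => hF ((hCw F).mpr h)) (hw.1 F)
  have hz' : ∀ F, F ∉ C' → w' F = 0 := fun F hF =>
    le_antisymm (not_lt.mp fun h => hF ((hCw' F).mpr h)) (hw'.1 F)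
  have hCS : ∀ F ∈ C, F ∈ S.faces := fun F hF =>
    mem_faces_of_mem_faces_cone ha (hC.2.1 F hF) (haw F ((hCw F).mp hF))
  have hCS' : ∀ F ∈ C', F ∈ S.faces := fun F hF =>
    mem_faces_of_mem_faces_cone ha (hC'.2.1 F hF) (haw' F ((hCw' F).mp hF))
  have hto := fun F hF =>
    E.exists_eqvGen_of_glueWeights_eq hS ha hC hC' hCw hw.1 hCw' hw'.1 h (F := F) hF
  have hfrom := fun F hF =>
    E.exists_eqvGen_of_glueWeights_eq hS ha hC' hC hCw' hw'.1 hCw hw.1 h.symm (F := F) hF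
  choose! f hf hfe hfw using hto
  obtain ⟨T, hT, hTmax⟩ := exists_greatest_of_isChain hC.1 hC.2.2
  have hcard : ∀ F ∈ C, F.card = (f F).card := fun F hF =>
    (matches_of_eqvGen (hfe F hF)).card_eq hS (hCS F hF) (hCS' _ (hf F hF))
  have hinj := E.injOn_mk_of_isChain hS ha hC.2.1 hC.2.2
  have hinj' := E.injOn_mk_of_isChain hS ha hC'.2.1 hC'.2.2
  have hsurj : ∀ F' ∈ C', ∃ F ∈ C, f F = F' := fun F' hF' => by
    obtain ⟨F, hF, hFF', -⟩ := hfrom F' hF'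
    refine ⟨F, hF, hinj' (hf F hF) hF' ?_⟩
    exact (Quot.eqvGen_sound (hfe F hF)).symm.trans (Quot.eqvGen_sound hFF').symm
  -- Equivalence of cells says nothing directly about inclusion, but members of `C'` are comparable
  -- and `f` preserves cardinality, which fixes the order.
  have hTmax' : ∀ F' ∈ C', F' ⊆ f T := fun F' hF' => by
    obtain ⟨F, hF, rfl⟩ := hsurj F' hF'
    rcases hC'.2.2.total (hf F hF) (hf T hT) with h1 | h1
    · exact h1
    · refine (Finset.eq_of_subset_of_card_le h1 ?_).symm.subset
      rw [← hcard F hF, ← hcard T hT]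
      exact Finset.card_le_card (hTmax F hF)
  refine mk_eq_mk_of_eqvGen hS (hfe T hT) (hCS T hT) s s' (fun v hv => ?_) (fun v hv => ?_)
    fun v hv u hu hvu => ?_
  · rw [hs]
    exact barycentricPoint_eq_zero _ fun F hF hvF =>
      hv (hTmax F (by by_contra h1; exact hF (hz F h1)) hvF)
  · rw [hs']
    exact barycentricPoint_eq_zero _ fun F hF hvF =>
      hv (hTmax' F (by by_contra h1; exact hF (hz' F h1)) hvF)
  · rw [hs, hs', barycentricPoint_eq_sum _ hC.2.1 hz, barycentricPoint_eq_sum _ hC'.2.1 hz']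
    refine Finset.sum_nbij f hf (fun F hF G hG hFG => ?_) hsurj fun F hF => ?_
    · refine hinj hF hG ((Quot.eqvGen_sound (hfe F hF)).trans ?_)
      rw [hFG]
      exact (Quot.eqvGen_sound (hfe G hG)).symm
    · have hm := matches_of_eqvGen (hfe F hF)
      -- Within the simplices `T` and `f T` equivalent vertices are equal, so the partner of `v` can
      -- only be `u`, and conversely.
      have : v ∈ F ↔ u ∈ f F := by
        constructor
        · intro hvF
          obtain ⟨u', hu', hvu'⟩ := hm.1 v hvF
          rwa [eq_of_vertexRel hS (hCS' _ (hf T hT)) hu (hTmax' _ (hf F hF) hu')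
            (E.vertexRel.trans (E.vertexRel.symm hvu) hvu')]
        · intro huF
          obtain ⟨v', hv', hvu'⟩ := hm.2 u huF
          rwa [eq_of_vertexRel hS (hCS _ hT) hv (hTmax _ hF hv')
            (E.vertexRel.trans hvu (E.vertexRel.symm hvu'))]
      simp only [this, hcard F hF, hfw F hF]

/-- Renaming the vertices of a simplex by equivalent ones does not change the image in the derived
structure. -/
theorem glueWeights_eq_of_image {w w' : Finset ℤ → ℝ}
    (hw : w ∈ realization (barycentricSubdivision (cone a S)))
    (hw' : w' ∈ realization (barycentricSubdivision (cone a S))) {T : Finset ℤ} (f : ℤ → ℤ)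
    (hf : Set.InjOn f T)
    (hwT : ∀ v, v ∉ T → barycentricPoint (finite_faces_cone hS ha) w v = 0)
    (hfT : ∀ F ⊆ T, F.Nonempty → F.image f ∈ (cone a S).faces ∧ E.FaceGlue F (F.image f))
    (h : ∀ v ∈ T, barycentricPoint (finite_faces_cone hS ha) w' (f v) =
      barycentricPoint (finite_faces_cone hS ha) w v)
    (h0 : ∀ u, u ∉ T.image f → barycentricPoint (finite_faces_cone hS ha) w' u = 0) :
    E.glueWeights a hS ha w = E.glueWeights a hS ha w' := by
  classical
  set hK := finite_faces_cone hS ha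
  obtain ⟨C, hC, hCw, hsum⟩ := exists_support_face hw
  have hz : ∀ F, F ∉ C → w F = 0 := fun F hF =>
    le_antisymm (not_lt.mp fun h => hF ((hCw F).mpr h)) (hw.1 F)
  have hCT : ∀ F ∈ C, F ⊆ T := fun F hF v hv => by
    by_contra h1
    have h2 := hwT v h1
    rw [barycentricPoint_eq_sum hK hC.2.1 hz, Finset.sum_eq_zero_iff_of_nonneg fun G _ => by
      split_ifs
      · exact div_nonneg (hw.1 G) (Nat.cast_nonneg _)
      · exact le_rfl] at h2
    have h3 := h2 F hF
    rw [if_pos hv] at h3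
    have : 0 < w F / F.card :=
      div_pos ((hCw F).mp hF) (by exact_mod_cast Finset.card_pos.mpr ⟨v, hv⟩)
    exact this.ne' h3
  have hne : ∀ F ∈ C, F.Nonempty := fun F hF => nonempty_of_mem_faces (hC.2.1 F hF)
  set D := C.image (Finset.image f) with hD
  have hCD : ∀ F ∈ C, F.image f ∈ D := fun F hF => Finset.mem_image_of_mem _ hF
  set w₁ := pushforward C (Finset.image f) w with hw₁
  have hz₁ : ∀ F, F ∉ D → w₁ F = 0 := fun F hF =>
    pushforward_eq_zero fun G hG h => hF (h ▸ hCD G hG)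
  have hDK : ∀ F ∈ D, F ∈ (cone a S).faces := by
    intro F hF
    obtain ⟨G, hG, rfl⟩ := Finset.mem_image.mp hF
    exact (hfT G (hCT G hG) (hne G hG)).1
  have hmem : w₁ ∈ realization (barycentricSubdivision (cone a S)) := by
    refine ⟨pushforward_nonneg hw.1, D, ⟨hC.1.image _, hDK, ?_⟩, hz₁, ?_⟩
    · intro F hF G hG _
      obtain ⟨F, hFC, rfl⟩ := Finset.mem_image.mp hF
      obtain ⟨G, hGC, rfl⟩ := Finset.mem_image.mp hG
      exact (hC.2.2.total hFC hGC).imp Finset.image_subset_image Finset.image_subset_image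
    · have := sum_pushforward (w := w) hCD fun _ => 1
      simpa [hsum] using this
  -- As `f` is injective on `T`, renaming preserves cardinalities and hence barycentres. Both
  -- weights therefore represent the same point of the cone, and weights in the barycentric
  -- subdivision are unique.
  have heq : w₁ = w' := by
    refine barycentricPoint_injOn hK hmem hw' ?_
    ext u
    by_cases hu : u ∈ T.image f
    · obtain ⟨v, hv, rfl⟩ := Finset.mem_image.mp hu
      rw [h v hv, barycentricPoint_eq_sum hK hDK hz₁, barycentricPoint_eq_sum hK hC.2.1 hz]
      have := sum_pushforward (w := w) hCD
        fun F => if f v ∈ F then ((F.card : ℝ))⁻¹ else 0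
      calc ∑ F ∈ D, (if f v ∈ F then w₁ F / F.card else 0)
          = ∑ F ∈ D, (if f v ∈ F then ((F.card : ℝ))⁻¹ else 0) * w₁ F :=
            Finset.sum_congr rfl fun F _ => by split_ifs <;> ring
        _ = _ := this
        _ = _ := Finset.sum_congr rfl fun F hF => by
            have h1 : f v ∈ F.image f ↔ v ∈ F := by
              constructor
              · intro h2
                obtain ⟨v', hv', hvv⟩ := Finset.mem_image.mp h2
                rwa [← hf (hCT F hF hv') hv hvv]
              · exact fun h2 => Finset.mem_image_of_mem f h2
            rw [Finset.card_image_of_injOn (hf.mono (Finset.coe_subset.mpr (hCT F hF)))]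
            simp only [h1]
            split_ifs <;> ring
    · rw [h0 u hu]
      refine barycentricPoint_eq_zero hK fun F hF huF => hu ?_
      have hFD : F ∈ D := by
        by_contra h1
        exact hF (hz₁ F h1)
      obtain ⟨G, hG, rfl⟩ := Finset.mem_image.mp hFD
      exact Finset.image_subset_image (hCT G hG) huF
  rw [← heq, E.glueWeights_eq hS ha hDK hz₁, E.glueWeights_eq hS ha hC.2.1 hz, hw₁,
    pushforward_pushforward hCD]
  ext c
  refine Finset.sum_congr rfl fun F hF => ?_
  have : Quot.mk E.FaceGlue F = Quot.mk E.FaceGlue (F.image f) :=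
    Quot.sound (hfT F (hCT F hF) (hne F hF)).2
  rw [this, Function.comp_apply]

/-- Identified points of the base have the same image in the derived structure. -/
theorem glueWeights_eq_of_pointGlue {w w' : Finset ℤ → ℝ}
    (hw : w ∈ realization (barycentricSubdivision (cone a S)))
    (hw' : w' ∈ realization (barycentricSubdivision (cone a S))) {s s' : realization S}
    (hs : barycentricPoint (finite_faces_cone hS ha) w = s.1)
    (hs' : barycentricPoint (finite_faces_cone hS ha) w' = s'.1) (h : E.PointGlue s s') :
    E.glueWeights a hS ha w = E.glueWeights a hS ha w' := by
  classical
  rcases h with ⟨g, p, hg, hp, hgp, hsg, hsp, hst⟩ | ⟨v, u, hvu, hsv, hsu⟩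
  · have hto := E.vertex_matching g p hg hp hgp
    have hfrom := E.vertex_matching p g hp hg (E.generatorRel.symm hgp)
    choose! f hf hfr using hto
    have hfinj : Set.InjOn f g := fun v hv v' hv' hvv =>
      E.vertex_injective g hg v hv v' hv' (E.vertexRel.trans (hfr v hv)
        (hvv ▸ E.vertexRel.symm (hfr v' hv')))
    have hfp : g.image f = p := by
      ext u
      rw [Finset.mem_image]
      constructor
      · rintro ⟨v, hv, rfl⟩
        exact hf v hv
      · intro hu
        obtain ⟨v, hv, huv⟩ := hfrom u hu
        exact ⟨v, hv, E.vertex_injective p hp _ (hf v hv) _ hu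
          (E.vertexRel.symm (E.vertexRel.trans huv (hfr v hv)))⟩
    refine E.glueWeights_eq_of_image hS ha hw hw' f hfinj (fun v hv => ?_) (fun F hF hne => ?_)
      (fun v hv => ?_) fun u hu => ?_
    · rw [hs]; exact hsg v hv
    · have hFp : F.image f ⊆ p := hfp ▸ Finset.image_subset_image hF
      refine ⟨mem_faces_cone_of_mem_faces (mem_faces_of_subset hp.1 hFp (hne.image f)),
        Or.inl ⟨g, p, hg, hp, hgp, hF, hFp, fun v hv => ?_, fun u hu => ?_⟩⟩
      · exact ⟨f v, Finset.mem_image_of_mem f hv, hfr v (hF hv)⟩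
      · obtain ⟨v, hv, rfl⟩ := Finset.mem_image.mp hu
        exact ⟨v, hv, hfr v (hF hv)⟩
    · rw [hs, hs']
      exact (hst v hv (f v) (hf v hv) (hfr v hv)).symm
    · rw [hs']
      exact hsp u fun h => hu (hfp ▸ h)
  · have key : ∀ (v : ℤ) (s : realization S), s.1 = Pi.single v 1 → {v} ∈ S.faces := by
      intro v s hsv
      obtain ⟨F, hF, hFs, -⟩ := exists_support_face s.2
      refine singleton_mem_faces hF ((hFs v).mpr ?_)
      rw [hsv, Pi.single_eq_same]
      exact zero_lt_one
    refine E.glueWeights_eq_of_image hS ha hw hw' (T := {v}) (fun _ => u) (by simp) (fun t ht => ?_)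
      (fun F hF hne => ?_) (fun t ht => ?_) fun t ht => ?_
    · rw [hs, hsv, Pi.single_eq_of_ne (by simpa using ht)]
    · obtain rfl := (Finset.subset_singleton_iff.mp hF).resolve_left hne.ne_empty
      rw [Finset.image_singleton]
      exact ⟨mem_faces_cone_of_mem_faces (key u s' hsu),
        Or.inr ⟨v, u, key v s hsv, key u s' hsu, hvu, rfl, rfl⟩⟩
    · obtain rfl := Finset.mem_singleton.mp ht
      rw [hs, hs', hsv, hsu, Pi.single_eq_same, Pi.single_eq_same]
    · rw [hs', hsu, Pi.single_eq_of_ne (by simpa using ht)]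

end RegularEquivalence

end Stellar

/-! ### The derived structure as a cone with glued base -/

namespace Stellar

open unitInterval Topology Set

namespace RegularEquivalence

variable {S : PreAbstractSimplicialComplex ℤ} (E : RegularEquivalence S) {a : ℤ}
  (hS : S.faces.Finite) (ha : {a} ∉ S.faces)

/-- The quotient map from the cone on `S` to the realization of the derived structure. -/
noncomputable def coneMap (x : realization (cone a S)) : realization (derivedStructure a E) :=
  ⟨E.glueWeights a hS ha ((barycentricHomeomorph (finite_faces_cone hS ha)).symm x).1,
    E.glueWeights_mem hS ha ((barycentricHomeomorph (finite_faces_cone hS ha)).symm x).2⟩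

theorem continuous_coneMap : Continuous (E.coneMap hS ha) :=
  ((E.continuous_glueWeights hS ha).comp (continuous_subtype_val.comp
    (barycentricHomeomorph (finite_faces_cone hS ha)).symm.continuous)).subtype_mk _

theorem barycentricPoint_symm (x : realization (cone a S)) :
    barycentricPoint (finite_faces_cone hS ha)
      ((barycentricHomeomorph (finite_faces_cone hS ha)).symm x).1 = x.1 := by
  rw [← coe_barycentricHomeomorph, Homeomorph.apply_symm_apply]

theorem surjective_coneMap : Function.Surjective (E.coneMap hS ha) := by
  intro d
  obtain ⟨w, hw, h⟩ := E.exists_glueWeights_eq hS ha d.2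
  refine ⟨barycentricHomeomorph (finite_faces_cone hS ha) ⟨w, hw⟩, Subtype.ext ?_⟩
  simp only [coneMap, Homeomorph.symm_apply_apply]
  exact h

/-- The dichotomy is whether some simplex containing `a` carries positive weight for one of the
points. If so, the image determines the point; otherwise both points lie in the base. -/
theorem coneMap_eq_cases {x x' : realization (cone a S)}
    (h : E.coneMap hS ha x = E.coneMap hS ha x') : x = x' ∨ (x.1 a = 0 ∧ x'.1 a = 0 ∧
      ∀ s s' : realization S, s.1 = x.1 → s'.1 = x'.1 →
        Quot.mk E.PointGlue s = Quot.mk E.PointGlue s') := by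
  have h' := congrArg Subtype.val h
  set e := barycentricHomeomorph (finite_faces_cone hS ha) with he
  have hx := barycentricPoint_symm hS ha x
  have hx' := barycentricPoint_symm hS ha x'
  by_cases h1 : ∃ G, 0 < (e.symm x).1 G ∧ a ∈ G
  · obtain ⟨G, hG, haG⟩ := h1
    left
    exact e.symm.injective (Subtype.ext
      (E.eq_of_glueWeights_eq hS ha (e.symm x).2 (e.symm x').2 h' hG haG))
  by_cases h2 : ∃ G, 0 < (e.symm x').1 G ∧ a ∈ G
  · obtain ⟨G, hG, haG⟩ := h2
    left
    exact e.symm.injective (Subtype.ext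
      (E.eq_of_glueWeights_eq hS ha (e.symm x').2 (e.symm x).2 h'.symm hG haG).symm)
  push Not at h1 h2
  right
  refine ⟨?_, ?_, fun s s' hs hs' => ?_⟩
  · rw [← hx]
    exact barycentricPoint_eq_zero _ fun F hF =>
      h1 F (lt_of_le_of_ne ((e.symm x).2.1 F) (Ne.symm hF))
  · rw [← hx']
    exact barycentricPoint_eq_zero _ fun F hF =>
      h2 F (lt_of_le_of_ne ((e.symm x').2.1 F) (Ne.symm hF))
  · exact E.mk_eq_mk_of_glueWeights_eq hS ha (e.symm x).2 (e.symm x').2 h' h1 h2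
      (hs.trans hx.symm) (hs'.trans hx'.symm)

theorem coneMap_eq_of_mk_eq {s s' : realization S}
    (h : Quot.mk E.PointGlue s = Quot.mk E.PointGlue s') :
    E.coneMap hS ha ⟨s.1, realization_subset_cone s.2⟩ =
      E.coneMap hS ha ⟨s'.1, realization_subset_cone s'.2⟩ := by
  induction Quot.eqvGen_exact h with
  | rel s s' h1 =>
    exact Subtype.ext (E.glueWeights_eq_of_pointGlue hS ha (Subtype.coe_prop _)
      (Subtype.coe_prop _) (barycentricPoint_symm hS ha _) (barycentricPoint_symm hS ha _) h1)
  | refl s => rfl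
  | symm s s' h1 ih => exact (ih (Quot.eqvGen_sound h1)).symm
  | trans s s' s'' h1 h2 ih₁ ih₂ =>
    exact (ih₁ (Quot.eqvGen_sound h1)).trans (ih₂ (Quot.eqvGen_sound h2))

/-- This collects the injectivity requirements of `ConeModel`. The coordinate at `a` is `1 - t`, so
it recovers the height and detects the base as `t = 1`. -/
theorem coneMap_conePoint_eq {s s' : realization S} {t t' : I}
    (h : E.coneMap hS ha ⟨conePoint a s.1 t, conePoint_mem ha s t.2.1 t.2.2⟩ =
      E.coneMap hS ha ⟨conePoint a s'.1 t', conePoint_mem ha s' t'.2.1 t'.2.2⟩) :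
    t = t' ∧ (0 < t → s = s' ∨ (t = 1 ∧ Quot.mk E.PointGlue s = Quot.mk E.PointGlue s')) := by
  rcases E.coneMap_eq_cases hS ha h with h1 | ⟨h1, h2, h3⟩
  · have h1 : conePoint a s.1 t = conePoint a s'.1 t' := congrArg Subtype.val h1
    have ht : t = t' := by
      have := congrFun h1 a
      ext
      simpa [conePoint] using this
    subst ht
    exact ⟨rfl, fun ht => Or.inl (conePoint_injective ha ht h1)⟩
  · simp only [conePoint, if_true] at h1 h2
    obtain rfl : t = 1 := Subtype.ext (by simpa using (sub_eq_zero.mp h1).symm)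
    obtain rfl : t' = 1 := Subtype.ext (by simpa using (sub_eq_zero.mp h2).symm)
    exact ⟨rfl, fun _ => Or.inr ⟨rfl, h3 s s' (conePoint_one ha s).symm
      (conePoint_one ha s').symm⟩⟩

/-- The realization of `a ⋆ (S/≃)`, where `|S|` is the boundary of a simplex, is the cone on that
boundary with its base glued. -/
noncomputable def coneModel {ι : Type*} [Fintype ι] (e : simplexSphere ι ≃ₜ realization S)
    (s₀ : simplexSphere ι) :
    ConeModel ι E.QuotientSpace (realization (derivedStructure a E)) where
  base := Quot.mk E.PointGlue ∘ e
  isQuotientMap_base := isQuotientMap_quot_mk.comp e.isQuotientMap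
  cyl p := E.coneMap hS ha ⟨conePoint a (e p.1).1 p.2, conePoint_mem ha (e p.1) p.2.2.1 p.2.2.2⟩
  continuous_cyl := by
    refine (E.continuous_coneMap hS ha).comp (Continuous.subtype_mk (continuous_pi fun v => ?_) _)
    simp only [conePoint]
    have h1 : Continuous fun p : simplexSphere ι × I => (p.2 : ℝ) :=
      continuous_subtype_val.comp continuous_snd
    have h2 : Continuous fun p : simplexSphere ι × I => (e p.1).1 v :=
      (continuous_apply v).comp (continuous_subtype_val.comp (e.continuous.comp continuous_fst))
    split_ifs
    · exact continuous_const.sub h1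
    · exact h1.mul h2
  surjective_cyl d := by
    obtain ⟨x, rfl⟩ := E.surjective_coneMap hS ha d
    obtain ⟨s, t, ht, ht', hst⟩ := exists_conePoint_eq ha (e s₀) x.2
    exact ⟨(e.symm s, ⟨t, ht, ht'⟩), by simp [hst]⟩
  apex_eq s s' := by
    congr 2
    ext v
    simp [conePoint]
  height_eq h := (E.coneMap_conePoint_eq hS ha h).1
  base_eq h ht := by
    rcases (E.coneMap_conePoint_eq hS ha h).2 ht with h1 | h1
    · exact congrArg (Quot.mk E.PointGlue) h1
    · exact h1.2
  inner_eq h ht ht' := by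
    rcases (E.coneMap_conePoint_eq hS ha h).2 ht with h1 | h1
    · exact e.injective h1
    · exact absurd h1.1 ht'.ne
  glue {s s'} h := by
    have := E.coneMap_eq_of_mk_eq hS ha h
    simpa [conePoint_one ha] using this

end RegularEquivalence

end Stellar

/-! ### The main theorem -/

theorem mainTheorem6 (n : ℕ) (hn : 2 < n)
    (M : PreAbstractSimplicialComplex ℤ)
    (hM : Stellar.IsStellarManifold n M)
    (hconn : ConnectedSpace (Stellar.realization M))
    (S : PreAbstractSimplicialComplex ℤ)
    (hS : Stellar.IsStellarSphere (n - 1) S)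
    (E : Stellar.RegularEquivalence S)
    (a : ℤ) (ha : {a} ∉ S.faces)
    (hstruct : Stellar.HasStellarStructure M a E)
    (x : Stellar.realization M) (y : E.QuotientSpace) :
    Nonempty (FundamentalGroup (Stellar.realization M) x ≃*
      FundamentalGroup E.QuotientSpace y) := by
  set T : Finset ℤ := Finset.Icc 1 (((n - 1 : ℕ) : ℤ) + 2) with hT
  -- The model sphere is the boundary of a simplex with `n + 1` vertices, so `2 < n` is exactly the
  -- dimension bound required by general position.
  have hcard : 4 ≤ Fintype.card T := by
    rw [Fintype.card_coe, hT, Int.card_Icc]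
    omega
  have hfin : S.faces.Finite := Stellar.finite_faces_of_finite_vertices
    (hS.finite_vertices_iff.mpr (T.finite_toSet.subset fun v hv =>
      hv.2.1 (Finset.mem_singleton_self v)))
  obtain ⟨e₁⟩ := hS.nonempty_homeomorph
  obtain ⟨e₂⟩ := Stellar.nonempty_homeomorph_simplexBoundary T
  obtain ⟨L, hL, hML⟩ := hstruct
  obtain ⟨e₃⟩ := hML.nonempty_homeomorph
  obtain ⟨e₄⟩ := Stellar.nonempty_homeomorph_of_isRenumbering hL
  let e := e₃.trans e₄.symm
  -- The base point `y` supplies a point of `|S|`, needed as the default direction at the apex.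
  obtain ⟨z, -⟩ := Quot.exists_rep y
  obtain ⟨f⟩ := Stellar.nonempty_fundamentalGroup_mulEquiv_of_homeomorph e x
  obtain ⟨g⟩ := (E.coneModel hfin ha (e₂.trans e₁.symm)
    ((e₂.trans e₁.symm).symm z)).nonempty_fundamentalGroup_mulEquiv hcard (e x) y
  exact ⟨f.trans g⟩
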